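/- Let $\mathcal A$ be an abelian category. For $n\ge 1$ let $\mathrm{Ext}^n_{\mathcal A}(A,B)$ be the Yoneda Ext group: the equivalence classes of $n$-fold exact sequences $0\to B\to Y_n\to\cdots\to Y_1\to A\to 0$ with the Baer sum, functorial in $A$ by pullback and in $B$ by pushout. A pair $(\mathcal X,\mathcal Y)$ of classes of objects is a cotorsion pair if $\mathcal Y=\{Y:\mathrm{Ext}^1_{\mathcal A}(X,Y)=0\ \forall X\in\mathcal X\}$ and $\mathcal X=\{X:\mathrm{Ext}^1_{\mathcal A}(X,Y)=0\ \forall Y\in\mathcal Y\}$; it is complete if every object $A$ has short exact sequences $0\to Y\to X\to A\to 0$ and $0\to A\to Y'\to X'\to 0$ with $X,X'\in\mathcal X$, $Y,Y'\in\mathcal Y$, and hereditary if $\mathrm{Ext}^i_{\mathcal A}(X,Y)=0$ for all $X\in\mathcal X$, $Y\in\mathcal Y$, $i\ge 1$. Let $\mathfrak M=(\mathcal Q,\mathcal W,\mathcal R)$ be a hereditary abelian model structure on $\mathcal A$: the class $\mathcal W$ has the 2 out of 3 property on short exact sequences, and $(\mathcal Q,\mathcal W\cap\mathcal R)$ and $(\mathcal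 Q\cap\mathcal W,\mathcal R)$ are complete hereditary cotorsion pairs. Put $\omega=\mathcal Q\cap\mathcal W\cap\mathcal R$, and write $f\sim^\omega g$ if $g-f$ factors through an object of $\omega$. For each object $A$ choose a cofibrant replacement $0\to F\to QA\xrightarrow{p_A}A\to 0$ ($QA\in\mathcal Q$, $F\in\mathcal W\cap\mathcal R$) and a fibrant replacement $0\to A\xrightarrow{j_A}RA\to G\to 0$ ($RA\in\mathcal R$, $G\in\mathcal Q\cap\mathcal W$). For $f:A\to B$ let $Q(f):QA\to QB$ and $R(f):RA\to RB$ be any morphisms with $p_BQ(f)=fp_A$ and $R(f)j_A=j_Bf$. The homotopy category $\mathrm{Ho}(\mathfrak M)$ has the objects of $\mathcal A$ and morphism groups $\mathrm{Ho}(\mathfrak M)(A,B)=\mathrm{Hom}_{\mathcal A}(RQA,RQB)/\!\sim^\omega$, and $\gamma:\mathcal A\to\mathrm{Ho}(\mathfrak M)$ is the functor that is the identity on objects and sends $f$ to the class of $R(Q(f))$. For each $A$ choose short exact sequences $0\to\Omega A\to W\to A\to 0$ and $0\to A\to W'\to\Sigma A\to 0$ with $W,W'\in\mathcal W$. For such a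 sequence $0\to X\to W\to Y\to 0$, a bifibrant approximation is a commutative diagram with short exact rows $$\begin{array}{ccccc} RQX&\to&\overline W&\to& RQY\\ \uparrow&&\uparrow&&\uparrow\\ QX&\to&\widetilde W&\to& QY\\ \downarrow&&\downarrow&&\downarrow\\ X&\to& W&\to& Y\end{array}$$ whose outer vertical morphisms are the replacement morphisms; choose one for each of these sequences. The loop functor $\Omega$ and the suspension functor $\Sigma$ are the endofunctors of $\mathrm{Ho}(\mathfrak M)$ given on objects by these choices and on morphisms by $\Omega[f]=[k]$ whenever $k:RQ\Omega A\to RQ\Omega B$ and $f:RQA\to RQB$ are the two ends of a morphism between the top rows of the chosen approximations (respectively by $\Sigma[k]=[f]$ for $k:RQA\to RQB$ and $f:RQ\Sigma A\to RQ\Sigma B$). For $n\ge 1$ put $\underline{\mathrm{Ext}}^n_{\mathrm{Ho}(\mathfrak M)}(A,B):=\mathrm{Ext}^n_{\mathcal A}(RQA,RQB)$, where a morphism $f$ in either variable acts through $R(Q(f))$; this is a functor $\mathcal A^{\mathrm{op}}\times\mathcal A\to\mathbf{Ab}$. Likewise $(A,B)\mapsto\mathrm{Ext}^n_{\mathcal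 A}(QA,RB)$ is a functor $\mathcal A^{\mathrm{op}}\times\mathcal A\to\mathbf{Ab}$ through $Q(f)$ and $R(g)$. **Theorem.** For all choices as above and all $n\ge 1$: 1. For each object $A$, $\underline{\mathrm{Ext}}^n_{\mathrm{Ho}(\mathfrak M)}(A,-):\mathcal A\to\mathbf{Ab}$ is an additive covariant functor, and every short exact sequence $0\to X_1\to X_2\to X_3\to 0$ in $\mathcal A$ is sent, for suitable connecting homomorphisms, to a long exact sequence $$\underline{\mathrm{Ext}}^1(A,X_1)\to\underline{\mathrm{Ext}}^1(A,X_2)\to\underline{\mathrm{Ext}}^1(A,X_3)\to\underline{\mathrm{Ext}}^2(A,X_1)\to\cdots$$ (exactness is asserted at all terms except the first). 2. For each object $B$, $\underline{\mathrm{Ext}}^n_{\mathrm{Ho}(\mathfrak M)}(-,B)$ is an additive contravariant functor $\mathcal A\to\mathbf{Ab}$, and every short exact sequence is sent, for suitable connecting homomorphisms, to a long exact sequence $$\underline{\mathrm{Ext}}^1(X_3,B)\to\underline{\mathrm{Ext}}^1(X_2,B)\to\underline{\mathrm{Ext}}^1(X_1,B)\to\underline{\mathrm{Ext}}^2(X_3,B)\to\cdots$$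 (exact at all terms except the first). The functors in 1 and 2 descend to $\mathrm{Ho}(\mathfrak M)$: there is a functor $E^n:\mathrm{Ho}(\mathfrak M)^{\mathrm{op}}\times\mathrm{Ho}(\mathfrak M)\to\mathbf{Ab}$ with $E^n(\gamma A,\gamma B)=\underline{\mathrm{Ext}}^n_{\mathrm{Ho}(\mathfrak M)}(A,B)$ as functors of $A$ and $B$; moreover $E^n$ may be taken naturally isomorphic, on $\mathrm{Ho}(\mathfrak M)^{\mathrm{op}}\times\mathrm{Ho}(\mathfrak M)$, to both $\mathrm{Ho}(\mathfrak M)(\Omega^n-,-)$ and $\mathrm{Ho}(\mathfrak M)(-,\Sigma^n-)$. 3. There is an isomorphism of groups $\underline{\mathrm{Ext}}^n_{\mathrm{Ho}(\mathfrak M)}(A,B)\cong\mathrm{Ext}^n_{\mathcal A}(QA,RB)$, natural in $A,B\in\mathcal A$. 4. There are isomorphisms of groups $$\mathrm{Ho}(\mathfrak M)(\Omega^nA,B)\cong\mathrm{Ext}^n_{\mathcal A}(QA,RB)\cong\mathrm{Ho}(\mathfrak M)(A,\Sigma^nB),$$ natural in $A,B\in\mathcal A$. -/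

import Mathlib

open CategoryTheory CategoryTheory.Limits

namespace HoveyExt

universe v u

variable {C : Type u} [Category.{v} C] [Abelian C]

open Abelian in
theorem efface_aux [HasDerivedCategory.{max u v} C] {A : C} {L : CochainComplex C ℤ}
    (φ : DerivedCategory.Q.obj ((HomologicalComplex.single C (ComplexShape.up ℤ) 0).obj A) ⟶
      DerivedCategory.Q.obj L) (n : ℤ) (hn : n < 0) [L.IsStrictlyLE n] :
    ∃ (E : C) (p : E ⟶ A), Epi p ∧
      DerivedCategory.Q.map ((HomologicalComplex.single C (ComplexShape.up ℤ) 0).map p) ≫ φ = 0 := by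
  have : CochainComplex.IsStrictlyLE ((HomologicalComplex.single C (ComplexShape.up ℤ) 0).obj A) 0 :=
    inferInstanceAs (((CochainComplex.singleFunctor C 0).obj A).IsStrictlyLE 0)
  obtain ⟨K, _, π, h, g, rfl⟩ := DerivedCategory.right_fac_of_isStrictlyLE φ 0
  have hq : QuasiIso π := by rwa [DerivedCategory.isIso_Q_map_iff_quasiIso] at h
  let e := K.iCyclesIso 0 (0 + 1) (by simp)
    ((K.isZero_of_isStrictlyLE 0 (0 + 1) (by simp)).eq_of_tgt _ _)
  let α : K.X 0 ⟶ A := e.inv ≫ K.homologyπ 0 ≫ HomologicalComplex.homologyMap π 0 ≫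
    (HomologicalComplex.singleObjHomologySelfIso _ _ _).hom
  have hα : Epi α := by
    have h1 : Epi (K.homologyπ 0) := inferInstance
    have h2 : IsIso (HomologicalComplex.homologyMap π 0) := inferInstance
    exact epi_comp' inferInstance (epi_comp' h1 (epi_comp' inferInstance inferInstance))
  have hf : π.f 0 = α ≫ (HomologicalComplex.singleObjXSelf (ComplexShape.up ℤ) 0 A).inv := by
    rw [← cancel_epi e.hom]
    dsimp [α, e]
    rw [Category.assoc, Category.assoc, Category.assoc,
      Iso.hom_inv_id_assoc,
      HomologicalComplex.homologyπ_naturality_assoc]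
    rw [HomologicalComplex.homologyπ_singleObjHomologySelfIso_hom_assoc,
      ← HomologicalComplex.singleObjCyclesSelfIso_inv_iCycles, Iso.hom_inv_id_assoc,
      HomologicalComplex.cyclesMap_i]
    rfl
  let s : (HomologicalComplex.single C (ComplexShape.up ℤ) 0).obj (K.X 0) ⟶ K :=
    HomologicalComplex.mkHomFromSingle (𝟙 _) (by
      rintro _ rfl
      apply (K.isZero_of_isStrictlyLE 0 (0 + 1) (by simp)).eq_of_tgt)
  have hs : (HomologicalComplex.single C (ComplexShape.up ℤ) 0).map α = s ≫ π := by
    apply HomologicalComplex.from_single_hom_ext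
    rw [HomologicalComplex.comp_f, HomologicalComplex.mkHomFromSingle_f, Category.assoc, hf]
    rw [HomologicalComplex.single_map_f_self, Category.id_comp]
  refine ⟨K.X 0, α, hα, ?_⟩
  have h0 : s ≫ g = 0 := by
    apply HomologicalComplex.from_single_hom_ext
    apply (L.isZero_of_isStrictlyLE n 0 hn).eq_of_tgt
  rw [hs, Functor.map_comp, Category.assoc, IsIso.hom_inv_id_assoc, ← Functor.map_comp, h0,
    Functor.map_zero]

theorem efface [HasExt.{max u v} C] {A B : C} {n : ℕ} (x : Abelian.Ext.{max u v} A B (n + 1)) :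
    ∃ (E : C) (p : E ⟶ A), Epi p ∧ (Abelian.Ext.mk₀ p).comp x (zero_add _) = 0 := by
  let := HasDerivedCategory.standard C
  obtain ⟨E, p, hp, h⟩ := efface_aux (x.hom ≫
    ((DerivedCategory.singleFunctors C).shiftIso (n + 1) (-(n + 1)) 0 (by lia)).hom.app _)
    (L := (CochainComplex.singleFunctor C (-(n + 1))).obj B) (-(n + 1)) (by lia)
  refine ⟨E, p, hp, ?_⟩
  apply Abelian.Ext.homEquiv.injective
  simp only [← cancel_mono (((DerivedCategory.singleFunctors C).shiftIso (n + 1) (-(n + 1)) 0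
    (by lia)).hom.app _), Abelian.Ext.zero_hom, Limits.zero_comp]
  have h1 := Abelian.Ext.singleFunctor_map_comp_hom p x
  have h2 : (DerivedCategory.singleFunctor C 0).map p ≫ x.hom ≫
    ((DerivedCategory.singleFunctors C).shiftIso (n + 1) (-(n + 1)) 0 (by lia)).hom.app _ = 0 := h
  rw [← Category.assoc] at h2
  exact (congrArg (· ≫ _) h1.symm).trans h2

/-! ### Yoneda extensions -/

/-- `NExt B A n` is the type of `n`-fold exact sequences `0 ⟶ B ⟶ Yₙ ⟶ ⋯ ⟶ Y₁ ⟶ A ⟶ 0`, presented as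
splicings of short exact sequences; for `n = 0` it is the type of morphisms `A ⟶ B`. -/
inductive NExt (B : C) : C → ℕ → Type (max u v)
  | hom {A : C} (f : A ⟶ B) : NExt B A 0
  | single {A E : C} (i : B ⟶ E) (p : E ⟶ A) (w : i ≫ p = 0)
      (h : (ShortComplex.mk i p w).ShortExact) : NExt B A 1
  | splice {A K E : C} {n : ℕ} (i : K ⟶ E) (p : E ⟶ A) (w : i ≫ p = 0)
      (h : (ShortComplex.mk i p w).ShortExact) (e : NExt B K (n + 1)) : NExt B A (n + 2)

/-- `NExt.Ladder α β e e'`: there is a commutative diagram from the exact sequence `e` to the exact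
sequence `e'`, with `β` on the left end and `α` on the right end. -/
inductive NExt.Ladder {B B' : C} (β : B ⟶ B') :
    {A A' : C} → (A ⟶ A') → {n : ℕ} → NExt B A n → NExt B' A' n → Prop
  | hom {A A' : C} (α : A ⟶ A') (f : A ⟶ B) (f' : A' ⟶ B') (h : f ≫ β = α ≫ f') :
      Ladder β α (.hom f) (.hom f')
  | single {A A' E E' : C} (α : A ⟶ A') (g : E ⟶ E')
      (i : B ⟶ E) (p : E ⟶ A) (w : i ≫ p = 0) (h : (ShortComplex.mk i p w).ShortExact)
      (i' : B' ⟶ E') (p' : E' ⟶ A') (w' : i' ≫ p' = 0) (h' : (ShortComplex.mk i' p' w').ShortExact)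
      (hi : i ≫ g = β ≫ i') (hp : g ≫ p' = p ≫ α) :
      Ladder β α (.single i p w h) (.single i' p' w' h')
  | splice {A A' K K' E E' : C} {n : ℕ} (α : A ⟶ A') (k : K ⟶ K') (g : E ⟶ E')
      (i : K ⟶ E) (p : E ⟶ A) (w : i ≫ p = 0) (h : (ShortComplex.mk i p w).ShortExact)
      (e : NExt B K (n + 1))
      (i' : K' ⟶ E') (p' : E' ⟶ A') (w' : i' ≫ p' = 0) (h' : (ShortComplex.mk i' p' w').ShortExact)
      (e' : NExt B' K' (n + 1))
      (hi : i ≫ g = k ≫ i') (hp : g ≫ p' = p ≫ α) (he : Ladder β k e e') :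
      Ladder β α (.splice i p w h e) (.splice i' p' w' h' e')

/-- Yoneda's `Extⁿ(A, B)`: the `n`-fold exact sequences from `B` to `A`, modulo the equivalence
relation generated by the commutative diagrams which are identities on both ends. -/
def YExt (A B : C) (n : ℕ) : Type (max u v) :=
  Quot (fun e e' : NExt B A n => NExt.Ladder (𝟙 B) (𝟙 A) e e')

section basic

theorem exists_lift {S : ShortComplex C} (hS : S.ShortExact) {T : C} (k : T ⟶ S.X₂)
    (hk : k ≫ S.g = 0) : ∃ l : T ⟶ S.X₁, l ≫ S.f = k :=
  have := hS.mono_f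
  ⟨hS.exact.lift k hk, hS.exact.lift_f k hk⟩

theorem exists_desc {S : ShortComplex C} (hS : S.ShortExact) {T : C} (k : S.X₂ ⟶ T)
    (hk : S.f ≫ k = 0) : ∃ l : S.X₃ ⟶ T, S.g ≫ l = k :=
  have := hS.epi_g
  ⟨hS.exact.desc k hk, hS.exact.g_desc k hk⟩

theorem shortExact_of_lift {S : ShortComplex C} (hm : Mono S.f) (he : Epi S.g)
    (H : ∀ {T : C} (k : T ⟶ S.X₂), k ≫ S.g = 0 → ∃ l : T ⟶ S.X₁, l ≫ S.f = k) :
    S.ShortExact where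
  mono_f := hm
  epi_g := he
  exact := S.exact_of_f_is_kernel
    (KernelFork.IsLimit.ofι' _ _ (fun k hk => ⟨(H k hk).choose, (H k hk).choose_spec⟩))

theorem shortExact_of_desc {S : ShortComplex C} (hm : Mono S.f) (he : Epi S.g)
    (H : ∀ {T : C} (k : S.X₂ ⟶ T), S.f ≫ k = 0 → ∃ l : S.X₃ ⟶ T, S.g ≫ l = k) :
    S.ShortExact where
  mono_f := hm
  epi_g := he
  exact := S.exact_of_g_is_cokernel
    (CokernelCofork.IsColimit.ofπ' _ _ (fun k hk => ⟨(H k hk).choose, (H k hk).choose_spec⟩))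

theorem shortExact_kernel {E A : C} (p : E ⟶ A) [hp : Epi p] :
    (ShortComplex.mk (kernel.ι p) p (kernel.condition p)).ShortExact where
  exact := ShortComplex.exact_of_f_is_kernel _ (kernelIsKernel p)
  mono_f := inferInstanceAs (Mono (kernel.ι p))
  epi_g := hp

theorem shortExact_pullback {K E A A' : C} (i : K ⟶ E) (p : E ⟶ A) (w : i ≫ p = 0)
    (h : (ShortComplex.mk i p w).ShortExact) (α : A' ⟶ A) :
    (ShortComplex.mk (pullback.lift i (0 : K ⟶ A') (by rw [w, zero_comp])) (pullback.snd p α)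
      (pullback.lift_snd _ _ _)).ShortExact := by
  have hm : Mono i := h.mono_f
  have he : Epi p := h.epi_g
  have w' : i ≫ p = (0 : K ⟶ A') ≫ α := by rw [w, zero_comp]
  have hM : Mono (pullback.lift i (0 : K ⟶ A') w' ≫ pullback.fst p α) := by
    rwa [pullback.lift_fst]
  refine shortExact_of_lift (mono_of_mono _ (pullback.fst p α))
    (inferInstanceAs (Epi (pullback.snd p α))) (fun {T} k hk => ?_)
  have hk' : k ≫ pullback.snd p α = 0 := hk
  obtain ⟨l, hl⟩ := exists_lift h (k ≫ pullback.fst p α)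
    (by dsimp; rw [Category.assoc, pullback.condition, reassoc_of% hk', zero_comp])
  refine ⟨l, pullback.hom_ext ?_ ?_⟩
  · exact (Category.assoc _ _ _).trans ((congrArg (l ≫ ·) (pullback.lift_fst _ _ _)).trans hl)
  · refine (Category.assoc _ _ _).trans ((congrArg (l ≫ ·) (pullback.lift_snd _ _ _)).trans ?_)
    rw [hk', comp_zero]

theorem shortExact_pushout {K E A K' : C} (i : K ⟶ E) (p : E ⟶ A) (w : i ≫ p = 0)
    (h : (ShortComplex.mk i p w).ShortExact) (β : K ⟶ K') :
    (ShortComplex.mk (pushout.inr i β) (pushout.desc p (0 : K' ⟶ A) (by rw [w, comp_zero]))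
      (pushout.inr_desc _ _ _)).ShortExact := by
  have hm : Mono i := h.mono_f
  have he : Epi p := h.epi_g
  have w' : i ≫ p = β ≫ (0 : K' ⟶ A) := by rw [w, comp_zero]
  have hE : Epi (pushout.inl i β ≫ pushout.desc p (0 : K' ⟶ A) w') := by
    rwa [pushout.inl_desc]
  refine shortExact_of_desc (inferInstanceAs (Mono (pushout.inr i β)))
    (epi_of_epi (pushout.inl i β) _) (fun {T} k hk => ?_)
  have hk' : pushout.inr i β ≫ k = 0 := hk
  obtain ⟨l, hl⟩ := exists_desc h (pushout.inl i β ≫ k)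
    (by dsimp; rw [← Category.assoc, pushout.condition, Category.assoc, hk', comp_zero])
  refine ⟨l, pushout.hom_ext ?_ ?_⟩
  · exact (Category.assoc _ _ _).symm.trans ((congrArg (· ≫ l) (pushout.inl_desc _ _ _)).trans hl)
  · refine (Category.assoc _ _ _).symm.trans
      ((congrArg (· ≫ l) (pushout.inr_desc _ _ _)).trans ?_)
    rw [hk', zero_comp]

theorem shortExact_biprod {K E A K' E' A' : C} (i : K ⟶ E) (p : E ⟶ A) (w : i ≫ p = 0)
    (h : (ShortComplex.mk i p w).ShortExact) (i' : K' ⟶ E') (p' : E' ⟶ A') (w' : i' ≫ p' = 0)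
    (h' : (ShortComplex.mk i' p' w').ShortExact) :
    (ShortComplex.mk (biprod.map i i') (biprod.map p p')
      (by ext <;> simp [w, w'])).ShortExact := by
  have hm : Mono i := h.mono_f
  have he : Epi p := h.epi_g
  have hm' : Mono i' := h'.mono_f
  have he' : Epi p' := h'.epi_g
  refine shortExact_of_lift (inferInstanceAs (Mono (biprod.map i i')))
    (inferInstanceAs (Epi (biprod.map p p'))) (fun {T} k hk => ?_)
  have hk' : k ≫ biprod.map p p' = 0 := hk
  have h1 : (k ≫ biprod.fst) ≫ p = 0 := by simpa using congrArg (· ≫ biprod.fst) hk'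
  have h2 : (k ≫ biprod.snd) ≫ p' = 0 := by simpa using congrArg (· ≫ biprod.snd) hk'
  obtain ⟨l, hl⟩ := exists_lift h _ h1
  obtain ⟨l', hl'⟩ := exists_lift h' _ h2
  refine ⟨biprod.lift l l', ?_⟩
  dsimp at hl hl' ⊢
  apply biprod.hom_ext
  · simpa using hl
  · simpa using hl'

end basic

namespace NExt

/-- Pullback of an exact sequence along a morphism to its right end. -/
noncomputable def pull {A A' B : C} (α : A' ⟶ A) : {n : ℕ} → NExt B A n → NExt B A' n
  | _, .hom f => .hom (α ≫ f)
  | _, .single i p w h => .single _ _ _ (shortExact_pullback i p w h α)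
  | _, .splice i p w h e => .splice _ _ _ (shortExact_pullback i p w h α) e

/-- Pushout of an exact sequence along a morphism from its left end. -/
noncomputable def push {B B' : C} (β : B ⟶ B') : {A : C} → {n : ℕ} → NExt B A n → NExt B' A n
  | _, _, .hom f => .hom (f ≫ β)
  | _, _, .single i p w h => .single _ _ _ (shortExact_pushout i p w h β)
  | _, _, .splice i p w h e => .splice i p w h (push β e)

/-- The direct sum of two exact sequences of the same length. -/
noncomputable def dsum {B B' : C} :
    {A A' : C} → {n : ℕ} → NExt B A n → NExt B' A' n → NExt (B ⊞ B') (A ⊞ A') n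
  | _, _, _, .hom f, .hom f' => .hom (biprod.map f f')
  | _, _, _, .single i p w h, .single i' p' w' h' =>
      .single _ _ _ (shortExact_biprod i p w h i' p' w' h')
  | _, _, _, .splice i p w h e, .splice i' p' w' h' e' =>
      .splice _ _ _ (shortExact_biprod i p w h i' p' w' h') (dsum e e')

/-- The Baer sum. -/
noncomputable def baer {A B : C} {n : ℕ} (e e' : NExt B A n) : NExt B A n :=
  ((dsum e e').push (biprod.desc (𝟙 B) (𝟙 B))).pull (biprod.lift (𝟙 A) (𝟙 A))

end NExt

section comparison

open Abelian

theorem hasExt : HasExt.{max u v} C := HasExt.standard C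

attribute [local instance] hasExt

theorem exists_mid {S S' : ShortComplex C} (hS : S.ShortExact) (hS' : S'.ShortExact)
    (α : S.X₁ ⟶ S'.X₁) (β : S.X₃ ⟶ S'.X₃)
    (H : hS.extClass.comp (Ext.mk₀ α) (add_zero 1) =
      (Ext.mk₀ β).comp hS'.extClass (zero_add 1)) :
    ∃ g : S.X₂ ⟶ S'.X₂, S.f ≫ g = α ≫ S'.f ∧ g ≫ S'.g = S.g ≫ β := by
  have h1 : (Ext.mk₀ (S.g ≫ β)).comp hS'.extClass (zero_add 1) = 0 := by
    rw [← Ext.mk₀_comp_mk₀_assoc, ← H, hS.comp_extClass_assoc]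
  obtain ⟨x, hx⟩ := Ext.covariant_sequence_exact₃ S.X₂ hS' (Ext.mk₀ (S.g ≫ β)) rfl h1
  obtain ⟨g, rfl⟩ := (Ext.mk₀_bijective _ _).2 x
  rw [Ext.mk₀_comp_mk₀] at hx
  have hg : g ≫ S'.g = S.g ≫ β := (Ext.mk₀_bijective _ _).1 hx
  obtain ⟨α', hα'⟩ := exists_lift hS' (S.f ≫ g) (by rw [Category.assoc, hg]; simp)
  let φ : S ⟶ S' := { τ₁ := α', τ₂ := g, τ₃ := β, comm₁₂ := hα', comm₂₃ := hg }
  have h2 : hS.extClass.comp (Ext.mk₀ (α - α')) (add_zero 1) = 0 := by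
    have := ShortComplex.ShortExact.extClass_naturality hS hS' φ
    rw [sub_eq_add_neg, Ext.mk₀_add, Ext.mk₀_neg, Ext.comp_add, Ext.comp_neg, H, ← this, add_neg_cancel]
  obtain ⟨y, hy⟩ := Ext.contravariant_sequence_exact₁ hS S'.X₁ (Ext.mk₀ (α - α')) rfl h2
  obtain ⟨m, rfl⟩ := (Ext.mk₀_bijective _ _).2 y
  rw [Ext.mk₀_comp_mk₀] at hy
  have hm : S.f ≫ m = α - α' := (Ext.mk₀_bijective _ _).1 hy
  refine ⟨g + m ≫ S'.f, ?_, ?_⟩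
  · rw [Preadditive.comp_add, reassoc_of% hm, ← hα', Preadditive.sub_comp]
    abel
  · rw [Preadditive.add_comp, hg, Category.assoc, S'.zero, comp_zero, add_zero]

namespace NExt

/-- The class of an exact sequence in `Abelian.Ext`. -/
noncomputable def cls {B : C} : {A : C} → {n : ℕ} → NExt B A n → Ext.{max u v} A B n
  | _, _, .hom f => Ext.mk₀ f
  | _, _, .single _ _ _ h => h.extClass
  | _, _, .splice _ _ _ h e => h.extClass.comp (cls e) (by omega)

theorem Ladder.cls_eq {B B' : C} {β : B ⟶ B'} {A A' : C} {α : A ⟶ A'} {n : ℕ} {e : NExt B A n}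
    {e' : NExt B' A' n} (H : Ladder β α e e') :
    e.cls.comp (Ext.mk₀ β) (add_zero n) = (Ext.mk₀ α).comp e'.cls (zero_add n) := by
  induction H with
  | hom α f f' h => simp [cls, h]
  | single α g i p w h i' p' w' h' hi hp =>
    exact ShortComplex.ShortExact.extClass_naturality h h'
      { τ₁ := β, τ₂ := g, τ₃ := α, comm₁₂ := hi.symm, comm₂₃ := hp }
  | splice α k g i p w h e i' p' w' h' e' hi hp he ih =>
    have := ShortComplex.ShortExact.extClass_naturality h h'
      { τ₁ := k, τ₂ := g, τ₃ := α, comm₁₂ := hi.symm, comm₂₃ := hp }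
    dsimp at this
    simp only [cls]
    rw [Ext.comp_assoc_of_third_deg_zero, ih, ← Ext.comp_assoc_of_second_deg_zero, this]
    rw [Ext.comp_assoc _ _ _ (zero_add 1) _ (by omega)]

theorem ladder_refl {B A : C} {n : ℕ} (e : NExt B A n) : Ladder (𝟙 B) (𝟙 A) e e := by
  induction e with
  | hom f => exact .hom _ _ _ (by simp)
  | single i p w h => exact .single _ (𝟙 _) _ _ _ _ _ _ _ _ (by simp) (by simp)
  | splice i p w h e ih => exact .splice _ (𝟙 _) (𝟙 _) _ _ _ _ _ _ _ _ _ _ (by simp) (by simp) ih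

theorem ladder_pull {B A A' : C} {n : ℕ} (α : A' ⟶ A) (e : NExt B A n) :
    Ladder (𝟙 B) α (e.pull α) e := by
  cases e with
  | hom f => exact .hom _ _ _ (by simp)
  | single i p w h =>
    exact .single _ (pullback.fst p α) _ _ _ _ _ _ _ _
      ((pullback.lift_fst _ _ _).trans (Category.id_comp _).symm) pullback.condition
  | splice i p w h e =>
    exact .splice _ (𝟙 _) (pullback.fst p α) _ _ _ _ _ _ _ _ _ _
      ((pullback.lift_fst _ _ _).trans (Category.id_comp _).symm) pullback.condition
      (ladder_refl e)

theorem ladder_push {B B' A : C} {n : ℕ} (β : B ⟶ B') (e : NExt B A n) :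
    Ladder β (𝟙 A) e (e.push β) := by
  induction e with
  | hom f => exact .hom _ _ _ (by simp)
  | single i p w h =>
    exact .single _ (pushout.inl i β) _ _ _ _ _ _ _ _ pushout.condition
      ((pushout.inl_desc _ _ _).trans (Category.comp_id _).symm)
  | splice i p w h e ih =>
    exact .splice _ (𝟙 _) (𝟙 _) _ _ _ _ _ _ _ _ _ _ (by simp) (by simp) ih

theorem cls_pull {B A A' : C} {n : ℕ} (α : A' ⟶ A) (e : NExt B A n) :
    (e.pull α).cls = (Ext.mk₀ α).comp e.cls (zero_add n) := by
  simpa using (ladder_pull α e).cls_eq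

theorem cls_push {B B' A : C} {n : ℕ} (β : B ⟶ B') (e : NExt B A n) :
    (e.push β).cls = e.cls.comp (Ext.mk₀ β) (add_zero n) := by
  simpa using (ladder_push β e).cls_eq.symm

theorem ladder_dsum_fst {B A B' A' : C} {n : ℕ} (e : NExt B A n) (e' : NExt B' A' n) :
    Ladder biprod.fst biprod.fst (e.dsum e') e := by
  induction e generalizing A' with
  | hom f => cases e' with | hom f' => exact .hom _ _ _ (by simp)
  | single i p w h =>
    cases e' with
    | single i' p' w' h' => exact .single _ biprod.fst _ _ _ _ _ _ _ _ (by simp) (by simp)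
  | splice i p w h e ih =>
    cases e' with
    | splice i' p' w' h' e' =>
      exact .splice _ biprod.fst biprod.fst _ _ _ _ _ _ _ _ _ _ (by simp) (by simp) (ih e')

theorem ladder_dsum_snd {B A B' A' : C} {n : ℕ} (e : NExt B A n) (e' : NExt B' A' n) :
    Ladder biprod.snd biprod.snd (e.dsum e') e' := by
  induction e generalizing A' with
  | hom f => cases e' with | hom f' => exact .hom _ _ _ (by simp)
  | single i p w h =>
    cases e' with
    | single i' p' w' h' => exact .single _ biprod.snd _ _ _ _ _ _ _ _ (by simp) (by simp)
  | splice i p w h e ih =>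
    cases e' with
    | splice i' p' w' h' e' =>
      exact .splice _ biprod.snd biprod.snd _ _ _ _ _ _ _ _ _ _ (by simp) (by simp) (ih e')

theorem cls_baer {A B : C} {n : ℕ} (e e' : NExt B A n) : (e.baer e').cls = e.cls + e'.cls := by
  have h1 := (ladder_dsum_fst e e').cls_eq
  have h2 := (ladder_dsum_snd e e').cls_eq
  have h3 : (biprod.desc (𝟙 B) (𝟙 B)) = biprod.fst + biprod.snd := by ext <;> simp
  rw [baer, cls_pull, cls_push, h3, Ext.mk₀_add, Ext.comp_add, h1, h2, Ext.comp_add,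
    Ext.mk₀_comp_mk₀_assoc, Ext.mk₀_comp_mk₀_assoc]
  simp

theorem cls_surjective {B : C} : ∀ {n : ℕ} {A : C} (x : Ext.{max u v} A B n),
    ∃ e : NExt B A n, e.cls = x
  | 0, A, x => by
    obtain ⟨f, rfl⟩ := (Ext.mk₀_bijective _ _).2 x
    exact ⟨.hom f, rfl⟩
  | 1, A, x => by
    obtain ⟨E, p, hp, h⟩ := efface x
    have hS := shortExact_kernel p
    obtain ⟨y, hy⟩ := Ext.contravariant_sequence_exact₃ hS B x h (n₀ := 0) rfl
    obtain ⟨f, rfl⟩ := (Ext.mk₀_bijective _ _).2 y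
    exact ⟨push f (.single _ _ _ hS), by rw [cls_push]; exact hy⟩
  | n + 2, A, x => by
    obtain ⟨E, p, hp, h⟩ := efface x
    have hS := shortExact_kernel p
    obtain ⟨y, hy⟩ := Ext.contravariant_sequence_exact₃ hS B x h (n₀ := n + 1) (by omega)
    obtain ⟨e, rfl⟩ := cls_surjective y
    exact ⟨.splice _ _ _ hS e, hy⟩

theorem quot_splice {A K E B : C} {n : ℕ} (i : K ⟶ E) (p : E ⟶ A) (w : i ≫ p = 0)
    (h : (ShortComplex.mk i p w).ShortExact) (e e' : NExt B K (n + 1))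
    (H : (Quot.mk _ e : YExt K B (n + 1)) = Quot.mk _ e') :
    (Quot.mk _ (.splice i p w h e) : YExt A B (n + 2)) = Quot.mk _ (.splice i p w h e') := by
  let F : YExt K B (n + 1) → YExt A B (n + 2) := Quot.map (fun e => .splice i p w h e)
    (fun e e' he => .splice _ (𝟙 _) (𝟙 _) _ _ _ _ _ _ _ _ _ _ (by simp) (by simp) he)
  exact congrArg F H

theorem quot_refine {A K E B E₁ K₁ : C} {n : ℕ} {i : K ⟶ E} {p : E ⟶ A} {w : i ≫ p = 0}
    (h : (ShortComplex.mk i p w).ShortExact) (e : NExt B K (n + 1))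
    {i₁ : K₁ ⟶ E₁} {p₁ : E₁ ⟶ A} {w₁ : i₁ ≫ p₁ = 0} (h₁ : (ShortComplex.mk i₁ p₁ w₁).ShortExact)
    (k : K₁ ⟶ K) (g : E₁ ⟶ E) (hk : i₁ ≫ g = k ≫ i) (hg : g ≫ p = p₁) :
    (Quot.mk _ (.splice i₁ p₁ w₁ h₁ (e.pull k)) : YExt A B (n + 2)) =
      Quot.mk _ (.splice i p w h e) :=
  Quot.sound (.splice _ k g _ _ _ _ _ _ _ _ _ _ hk (by simp [hg]) (ladder_pull k e))

theorem cls_refine {A K E B E₁ K₁ : C} {n : ℕ} {i : K ⟶ E} {p : E ⟶ A} {w : i ≫ p = 0}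
    (h : (ShortComplex.mk i p w).ShortExact) (e : NExt B K (n + 1))
    {i₁ : K₁ ⟶ E₁} {p₁ : E₁ ⟶ A} {w₁ : i₁ ≫ p₁ = 0} (h₁ : (ShortComplex.mk i₁ p₁ w₁).ShortExact)
    (k : K₁ ⟶ K) (g : E₁ ⟶ E) (hk : i₁ ≫ g = k ≫ i) (hg : g ≫ p = p₁) :
    (NExt.splice i₁ p₁ w₁ h₁ (e.pull k)).cls = (NExt.splice i p w h e).cls := by
  have H : Ladder (𝟙 B) (𝟙 A) (NExt.splice i₁ p₁ w₁ h₁ (e.pull k)) (NExt.splice i p w h e) :=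
    .splice _ k g _ _ _ _ _ _ _ _ _ _ hk (by simp [hg]) (ladder_pull k e)
  simpa using H.cls_eq

theorem quot_eq_step {A K E B : C} {n : ℕ} {i : K ⟶ E} {p : E ⟶ A} {w : i ≫ p = 0}
    (h : (ShortComplex.mk i p w).ShortExact) (e e' : NExt B K (n + 1))
    (IH : ∀ {A : C} (e e' : NExt B A (n + 1)), e.cls = e'.cls →
      (Quot.mk _ e : YExt A B (n + 1)) = Quot.mk _ e')
    (H : (NExt.splice i p w h e).cls = (NExt.splice i p w h e').cls) :
    (Quot.mk _ (.splice i p w h e) : YExt A B (n + 2)) = Quot.mk _ (.splice i p w h e') := by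
  have hp := h.epi_g
  dsimp at hp
  have H' : h.extClass.comp (e.cls - e'.cls) (by omega : 1 + (n + 1) = n + 2) = 0 := by
    rw [sub_eq_add_neg, Ext.comp_add, Ext.comp_neg]
    exact sub_eq_zero.2 H |>.symm ▸ (sub_eq_add_neg _ _).symm
  obtain ⟨y, hy⟩ := Ext.contravariant_sequence_exact₁ h B _ _ H'
  obtain ⟨E₁, g, hg, hgy⟩ := efface y
  have hS := shortExact_kernel (g ≫ p)
  obtain ⟨k, hk⟩ := exists_lift h (kernel.ι (g ≫ p) ≫ g)
    (by dsimp; rw [Category.assoc, kernel.condition])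
  dsimp at hk hy
  rw [← quot_refine h e hS k g hk.symm rfl, ← quot_refine h e' hS k g hk.symm rfl]
  apply quot_splice
  apply IH
  rw [cls_pull, cls_pull, ← sub_eq_zero, sub_eq_add_neg, ← Ext.comp_neg, ← Ext.comp_add,
    ← sub_eq_add_neg, ← hy, Ext.mk₀_comp_mk₀_assoc, hk, ← Ext.mk₀_comp_mk₀_assoc, hgy, Ext.comp_zero]

theorem quot_eq_of_cls_eq {B : C} : ∀ {n : ℕ} {A : C} (e e' : NExt B A n), e.cls = e'.cls →
    (Quot.mk _ e : YExt A B n) = Quot.mk _ e'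
  | 0, A, .hom f, .hom f', H => by
    have : f = f' := (Ext.mk₀_bijective _ _).1 H
    rw [this]
  | 1, A, .single i p w h, .single i' p' w' h', H => by
    obtain ⟨g, h1, h2⟩ := exists_mid h h' (𝟙 B) (𝟙 A) (by simpa [cls] using! H)
    exact Quot.sound (.single _ g _ _ _ _ _ _ _ _ h1 h2)
  | n + 2, A, .splice (E := E) (K := K) i p w h e, .splice (E := E') (K := K') i' p' w' h' e', H => by
    have := h.epi_g
    have := h'.epi_g
    dsimp at *
    have hS := shortExact_kernel (pullback.fst p p' ≫ p)
    obtain ⟨k, hk⟩ := exists_lift h (kernel.ι (pullback.fst p p' ≫ p) ≫ pullback.fst p p')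
      (by dsimp; rw [Category.assoc, kernel.condition])
    obtain ⟨k', hk'⟩ := exists_lift h' (kernel.ι (pullback.fst p p' ≫ p) ≫ pullback.snd p p')
      (by dsimp; rw [Category.assoc, ← pullback.condition, kernel.condition])
    rw [← quot_refine h e hS k _ hk.symm rfl,
      ← quot_refine h' e' hS k' _ hk'.symm pullback.condition.symm]
    refine quot_eq_step hS _ _ quot_eq_of_cls_eq ?_
    rw [cls_refine h e hS k _ hk.symm rfl,
      cls_refine h' e' hS k' _ hk'.symm pullback.condition.symm, H]

end NExt

namespace YExt

variable {A A' A'' B B' B'' : C} {n : ℕ}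

/-- The comparison map from Yoneda's `Ext` to `Abelian.Ext`. -/
noncomputable def toExt : YExt A B n → Ext.{max u v} A B n :=
  Quot.lift NExt.cls (fun _ _ H => by simpa using H.cls_eq)

theorem toExt_injective : Function.Injective (toExt : YExt A B n → Ext.{max u v} A B n) := by
  rintro ⟨e⟩ ⟨e'⟩ H
  exact NExt.quot_eq_of_cls_eq e e' H

theorem toExt_surjective : Function.Surjective (toExt : YExt A B n → Ext.{max u v} A B n) := by
  intro x
  obtain ⟨e, rfl⟩ := NExt.cls_surjective x
  exact ⟨Quot.mk _ e, rfl⟩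

theorem ladder_cls {e e' : NExt B A n} (H : NExt.Ladder (𝟙 B) (𝟙 A) e e') : e.cls = e'.cls := by
  simpa using H.cls_eq

/-- The addition is the Baer sum. -/
noncomputable instance : Add (YExt A B n) where
  add := Quot.lift₂ (fun e e' => Quot.mk _ (NExt.baer e e'))
    (fun e e₁ e₂ h => NExt.quot_eq_of_cls_eq _ _ (by
      rw [NExt.cls_baer, NExt.cls_baer, ladder_cls h]))
    (fun e₁ e₂ e h => NExt.quot_eq_of_cls_eq _ _ (by
      rw [NExt.cls_baer, NExt.cls_baer, ladder_cls h]))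

theorem toExt_add (x y : YExt A B n) : (x + y).toExt = x.toExt + y.toExt := by
  obtain ⟨e⟩ := x
  obtain ⟨e'⟩ := y
  exact NExt.cls_baer e e'

noncomputable instance : Zero (YExt A B n) where
  zero := (toExt_surjective 0).choose

theorem toExt_zero : (0 : YExt A B n).toExt = 0 := (toExt_surjective 0).choose_spec

/-- The map induced by pulling back along a morphism, as a map of sets. -/
noncomputable def pullFun (α : A' ⟶ A) : YExt A B n → YExt A' B n :=
  Quot.lift (fun e => Quot.mk _ (e.pull α)) (fun e e' h => NExt.quot_eq_of_cls_eq _ _ (by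
    rw [NExt.cls_pull, NExt.cls_pull, ladder_cls h]))

/-- The map induced by pushing out along a morphism, as a map of sets. -/
noncomputable def pushFun (β : B ⟶ B') : YExt A B n → YExt A B' n :=
  Quot.lift (fun e => Quot.mk _ (e.push β)) (fun e e' h => NExt.quot_eq_of_cls_eq _ _ (by
    rw [NExt.cls_push, NExt.cls_push, ladder_cls h]))

theorem toExt_pullFun (α : A' ⟶ A) (x : YExt A B n) :
    (pullFun α x).toExt = (Ext.mk₀ α).comp x.toExt (zero_add n) := by
  obtain ⟨e⟩ := x
  exact NExt.cls_pull α e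

theorem toExt_pushFun (β : B ⟶ B') (x : YExt A B n) :
    (pushFun β x).toExt = x.toExt.comp (Ext.mk₀ β) (add_zero n) := by
  obtain ⟨e⟩ := x
  exact NExt.cls_push β e

noncomputable instance : Neg (YExt A B n) where
  neg := pushFun (-𝟙 B)

theorem toExt_neg (x : YExt A B n) : (-x).toExt = -x.toExt := by
  refine (toExt_pushFun _ x).trans ?_
  rw [Ext.mk₀_neg, Ext.comp_neg, Ext.comp_mk₀_id]

noncomputable instance : AddCommGroup (YExt A B n) where
  add_assoc x y z := toExt_injective (by simp only [toExt_add, add_assoc])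
  zero_add x := toExt_injective (by simp only [toExt_add, toExt_zero, zero_add])
  add_zero x := toExt_injective (by simp only [toExt_add, toExt_zero, add_zero])
  add_comm x y := toExt_injective (by simp only [toExt_add, add_comm])
  neg_add_cancel x := toExt_injective (by
    simp only [toExt_add, toExt_neg, toExt_zero, neg_add_cancel])
  nsmul := nsmulRec
  zsmul := zsmulRec

/-- Yoneda's `Ext` groups are canonically isomorphic to the groups `Abelian.Ext`. -/
noncomputable def equiv : YExt A B n ≃+ Ext.{max u v} A B n where
  toEquiv := Equiv.ofBijective toExt ⟨toExt_injective, toExt_surjective⟩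
  map_add' := toExt_add

/-- `Extⁿ(A, B) ⟶ Extⁿ(A', B)`, the pullback along `α : A' ⟶ A`. -/
noncomputable def pull (α : A' ⟶ A) : YExt A B n →+ YExt A' B n where
  toFun := pullFun α
  map_zero' := toExt_injective (by rw [toExt_pullFun, toExt_zero, toExt_zero, Ext.comp_zero])
  map_add' x y := toExt_injective (by
    simp only [toExt_pullFun, toExt_add, Ext.comp_add])

/-- `Extⁿ(A, B) ⟶ Extⁿ(A, B')`, the pushout along `β : B ⟶ B'`. -/
noncomputable def push (β : B ⟶ B') : YExt A B n →+ YExt A B' n where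
  toFun := pushFun β
  map_zero' := toExt_injective (by rw [toExt_pushFun, toExt_zero, toExt_zero, Ext.zero_comp])
  map_add' x y := toExt_injective (by
    simp only [toExt_pushFun, toExt_add, Ext.add_comp])

theorem toExt_pull (α : A' ⟶ A) (x : YExt A B n) :
    (pull α x).toExt = (Ext.mk₀ α).comp x.toExt (zero_add n) := toExt_pullFun α x

theorem toExt_push (β : B ⟶ B') (x : YExt A B n) :
    (push β x).toExt = x.toExt.comp (Ext.mk₀ β) (add_zero n) := toExt_pushFun β x

theorem pull_id (x : YExt A B n) : pull (𝟙 A) x = x :=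
  toExt_injective (by simp [toExt_pull])

theorem push_id (x : YExt A B n) : push (𝟙 B) x = x :=
  toExt_injective (by simp [toExt_push])

theorem pull_comp (α' : A'' ⟶ A') (α : A' ⟶ A) (x : YExt A B n) :
    pull (α' ≫ α) x = pull α' (pull α x) :=
  toExt_injective (by simp only [toExt_pull, Ext.mk₀_comp_mk₀_assoc])

theorem push_comp (β : B ⟶ B') (β' : B' ⟶ B'') (x : YExt A B n) :
    push (β ≫ β') x = push β' (push β x) :=
  toExt_injective (by simp only [toExt_push, Ext.comp_assoc_of_third_deg_zero, Ext.mk₀_comp_mk₀])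

theorem pull_push (α : A' ⟶ A) (β : B ⟶ B') (x : YExt A B n) :
    pull α (push β x) = push β (pull α x) :=
  toExt_injective (by simp only [toExt_push, toExt_pull, Ext.comp_assoc_of_third_deg_zero])

theorem pull_sub (α α' : A' ⟶ A) (x : YExt A B n) : pull (α' - α) x = pull α' x - pull α x := by
  rw [eq_sub_iff_add_eq]
  refine toExt_injective ?_
  rw [toExt_add, toExt_pull, toExt_pull, toExt_pull, ← Ext.add_comp, ← Ext.mk₀_add, sub_add_cancel]

theorem push_sub (β β' : B ⟶ B') (x : YExt A B n) : push (β' - β) x = push β' x - push β x := by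
  rw [eq_sub_iff_add_eq]
  refine toExt_injective ?_
  rw [toExt_add, toExt_push, toExt_push, toExt_push, ← Ext.comp_add, ← Ext.mk₀_add, sub_add_cancel]

theorem ext_eq_zero [Subsingleton (YExt A B n)] (x : Ext.{max u v} A B n) : x = 0 := by
  exact (equiv (A := A) (B := B) (n := n)).symm.injective (Subsingleton.elim _ _)

theorem subsingleton_of (H : ∀ x : Ext.{max u v} A B n, x = 0) : Subsingleton (YExt A B n) :=
  ⟨fun _ _ => toExt_injective ((H _).trans (H _).symm)⟩

end YExt

end comparison

/-! ### Hereditary abelian model structures -/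

/-- `(X, Y)` is a cotorsion pair: the classes are the `Ext¹`-orthogonals of each other. -/
structure IsCotorsionPair (X Y : ObjectProperty C) : Prop where
  right : ∀ B, Y B ↔ ∀ A, X A → Subsingleton (YExt A B 1)
  left : ∀ A, X A ↔ ∀ B, Y B → Subsingleton (YExt A B 1)

/-- A special precover (relative to the pair of classes `(X, Y)`) of the object `A`. -/
structure SpecialPrecover (X Y : ObjectProperty C) (A : C) where
  {ker obj : C}
  ι : ker ⟶ obj
  π : obj ⟶ A
  w : ι ≫ π = 0
  shortExact : (ShortComplex.mk ι π w).ShortExact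
  mem_ker : Y ker
  mem : X obj

/-- A special preenvelope (relative to the pair of classes `(X, Y)`) of the object `A`. -/
structure SpecialPreenvelope (X Y : ObjectProperty C) (A : C) where
  {obj coker : C}
  ι : A ⟶ obj
  π : obj ⟶ coker
  w : ι ≫ π = 0
  shortExact : (ShortComplex.mk ι π w).ShortExact
  mem : Y obj
  mem_coker : X coker

/-- Completeness of a cotorsion pair: enough projectives and enough injectives. -/
structure IsComplete (X Y : ObjectProperty C) : Prop where
  enoughProjectives : ∀ A, Nonempty (SpecialPrecover X Y A)
  enoughInjectives : ∀ A, Nonempty (SpecialPreenvelope X Y A)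

/-- The hereditary condition on a cotorsion pair. -/
def IsHereditary (X Y : ObjectProperty C) : Prop :=
  ∀ A B, X A → Y B → ∀ i : ℕ, 1 ≤ i → Subsingleton (YExt A B i)

/-- The 2 out of 3 property on short exact sequences. -/
structure IsThick (W : ObjectProperty C) : Prop where
  mid : ∀ S : ShortComplex C, S.ShortExact → W S.X₁ → W S.X₃ → W S.X₂
  left : ∀ S : ShortComplex C, S.ShortExact → W S.X₂ → W S.X₃ → W S.X₁
  right : ∀ S : ShortComplex C, S.ShortExact → W S.X₁ → W S.X₂ → W S.X₃

variable (C) in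
/-- An abelian model structure `(𝒬, 𝒲, ℛ)` on an abelian category, presented as a Hovey triple. -/
structure AbelianModelStructure where
  /-- the cofibrant objects -/
  cof : ObjectProperty C
  /-- the trivial objects -/
  triv : ObjectProperty C
  /-- the fibrant objects -/
  fib : ObjectProperty C
  thick : IsThick triv
  left_cotorsion : IsCotorsionPair cof (triv ⊓ fib)
  left_complete : IsComplete cof (triv ⊓ fib)
  right_cotorsion : IsCotorsionPair (cof ⊓ triv) fib
  right_complete : IsComplete (cof ⊓ triv) fib

variable (C) in
/-- A hereditary abelian model structure: both associated cotorsion pairs are hereditary. -/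
structure HereditaryModelStructure extends AbelianModelStructure C where
  left_hereditary : IsHereditary cof (triv ⊓ fib)
  right_hereditary : IsHereditary (cof ⊓ triv) fib

section lifting

open Abelian

attribute [local instance] hasExt

theorem lift_of_ext {S : ShortComplex C} (hS : S.ShortExact) {X : C}
    (hX : Subsingleton (YExt X S.X₁ 1)) (x : X ⟶ S.X₃) : ∃ l : X ⟶ S.X₂, l ≫ S.g = x := by
  obtain ⟨y, hy⟩ := Ext.covariant_sequence_exact₃ X hS (Ext.mk₀ x) rfl (YExt.ext_eq_zero _)
  obtain ⟨l, rfl⟩ := (Ext.mk₀_bijective _ _).2 y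
  rw [Ext.mk₀_comp_mk₀] at hy
  exact ⟨l, (Ext.mk₀_bijective _ _).1 hy⟩

theorem extend_of_ext {S : ShortComplex C} (hS : S.ShortExact) {Y : C}
    (hY : Subsingleton (YExt S.X₃ Y 1)) (y : S.X₁ ⟶ Y) : ∃ l : S.X₂ ⟶ Y, S.f ≫ l = y := by
  obtain ⟨z, hz⟩ := Ext.contravariant_sequence_exact₁ hS Y (Ext.mk₀ y) rfl (YExt.ext_eq_zero _)
  obtain ⟨l, rfl⟩ := (Ext.mk₀_bijective _ _).2 z
  rw [Ext.mk₀_comp_mk₀] at hz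
  exact ⟨l, (Ext.mk₀_bijective _ _).1 hz⟩

theorem ext_mid_left {S : ShortComplex C} (hS : S.ShortExact) {Y : C} {n : ℕ}
    (h₁ : Subsingleton (YExt S.X₁ Y n)) (h₃ : Subsingleton (YExt S.X₃ Y n)) :
    Subsingleton (YExt S.X₂ Y n) := YExt.subsingleton_of (fun x => by
  obtain ⟨y, rfl⟩ := Ext.contravariant_sequence_exact₂ hS Y x (YExt.ext_eq_zero _)
  rw [YExt.ext_eq_zero y, Ext.comp_zero])

theorem ext_mid_right {S : ShortComplex C} (hS : S.ShortExact) {X : C} {n : ℕ}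
    (h₁ : Subsingleton (YExt X S.X₁ n)) (h₃ : Subsingleton (YExt X S.X₃ n)) :
    Subsingleton (YExt X S.X₂ n) := YExt.subsingleton_of (fun x => by
  obtain ⟨y, rfl⟩ := Ext.covariant_sequence_exact₂ X hS x (YExt.ext_eq_zero _)
  rw [YExt.ext_eq_zero y, Ext.zero_comp])

theorem pull_eq_zero {X V X' Y : C} (a : X ⟶ V) (b : V ⟶ X') {n : ℕ}
    (hV : Subsingleton (YExt V Y n)) (x : YExt X' Y n) : YExt.pull (a ≫ b) x = 0 := by
  rw [YExt.pull_comp, Subsingleton.elim (YExt.pull b x) 0, map_zero]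

theorem push_eq_zero {Y V Y' X : C} (a : Y ⟶ V) (b : V ⟶ Y') {n : ℕ}
    (hV : Subsingleton (YExt X V n)) (x : YExt X Y n) : YExt.push (a ≫ b) x = 0 := by
  rw [YExt.push_comp, Subsingleton.elim (YExt.push a x) 0, map_zero]

theorem subsingleton_of_isZero {A B : C} {n : ℕ} (hA : IsZero A) : Subsingleton (YExt A B n) :=
  YExt.subsingleton_of (fun x => by
    rw [← Ext.mk₀_id_comp x, hA.eq_of_src (𝟙 A) 0, Ext.mk₀_zero, Ext.zero_comp])

theorem subsingleton_of_isZero' {A B : C} {n : ℕ} (hB : IsZero B) : Subsingleton (YExt A B n) :=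
  YExt.subsingleton_of (fun x => by
    rw [← Ext.comp_mk₀_id x, hB.eq_of_src (𝟙 B) 0, Ext.mk₀_zero, Ext.comp_zero])

end lifting

theorem shortExact_inl_snd (X Y : C) :
    (ShortComplex.mk (biprod.inl : X ⟶ X ⊞ Y) (biprod.snd : X ⊞ Y ⟶ Y) (by simp)).ShortExact :=
  shortExact_of_lift (inferInstanceAs (Mono (biprod.inl : X ⟶ X ⊞ Y)))
    (inferInstanceAs (Epi (biprod.snd : X ⊞ Y ⟶ Y))) (fun {T} k hk => by
      have hk' : k ≫ biprod.snd = 0 := hk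
      refine ⟨k ≫ biprod.fst, ?_⟩
      dsimp
      ext <;> simp [hk'])

theorem triv_of_epi {W : ObjectProperty C} (hW : IsThick W) {S S' : ShortComplex C}
    (hS : S.ShortExact) (hS' : S'.ShortExact) (φ : S ⟶ S') {K₁ K₃ : C}
    {i₁ : K₁ ⟶ S.X₁} {w₁ : i₁ ≫ φ.τ₁ = 0} (h₁ : (ShortComplex.mk i₁ φ.τ₁ w₁).ShortExact)
    {i₃ : K₃ ⟶ S.X₃} {w₃ : i₃ ≫ φ.τ₃ = 0} (h₃ : (ShortComplex.mk i₃ φ.τ₃ w₃).ShortExact)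
    (hK₁ : W K₁) (hK₃ : W K₃) (hm : W S'.X₂) : W S.X₂ := by
  have := hS.mono_f
  have := hS.epi_g
  have := hS'.mono_f
  have := hS'.epi_g
  have e₁ : Epi φ.τ₁ := h₁.epi_g
  have e₃ : Epi φ.τ₃ := h₃.epi_g
  have m₁ : Mono i₁ := h₁.mono_f
  have m₃ : Mono i₃ := h₃.mono_f
  have e₂ : Epi φ.τ₂ := ShortComplex.epi_τ₂_of_exact_of_epi φ hS'.exact
  have c₁ := φ.comm₁₂
  have c₂ := φ.comm₂₃
  have hκ := shortExact_kernel φ.τ₂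
  obtain ⟨a, ha⟩ := exists_lift hκ (i₁ ≫ S.f)
    (by dsimp; rw [Category.assoc, ← c₁, reassoc_of% w₁, zero_comp])
  obtain ⟨b, hb⟩ := exists_lift h₃ (kernel.ι φ.τ₂ ≫ S.g)
    (by dsimp; rw [Category.assoc, ← c₂, kernel.condition_assoc, zero_comp])
  dsimp at ha hb
  have hab : a ≫ b = 0 := by
    rw [← cancel_mono i₃, Category.assoc, hb, reassoc_of% ha, S.zero, comp_zero, zero_comp]
  have ma : Mono a := by
    have : Mono (a ≫ kernel.ι φ.τ₂) := by rw [ha]; infer_instance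
    exact mono_of_mono a (kernel.ι φ.τ₂)
  have eb : Epi b := by
    rw [epi_iff_surjective_up_to_refinements]
    intro T t
    obtain ⟨T', π, hπ, x, hx⟩ := surjective_up_to_refinements_of_epi S.g (t ≫ i₃)
    obtain ⟨y, hy⟩ := exists_lift hS' (x ≫ φ.τ₂) (by
      rw [Category.assoc, c₂, ← reassoc_of% hx, w₃, comp_zero, comp_zero])
    obtain ⟨T'', π', hπ', z, hz⟩ := surjective_up_to_refinements_of_epi φ.τ₁ y
    obtain ⟨l, hl⟩ := exists_lift hκ (π' ≫ x - z ≫ S.f) (by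
      dsimp
      rw [Preadditive.sub_comp, Category.assoc, Category.assoc, ← hy, ← c₁, reassoc_of% hz, sub_self])
    dsimp at hl
    refine ⟨T'', π' ≫ π, inferInstance, l, ?_⟩
    rw [← cancel_mono i₃, Category.assoc, Category.assoc, Category.assoc, hb, reassoc_of% hl,
      Preadditive.sub_comp, Category.assoc, Category.assoc, S.zero, comp_zero, sub_zero, hx]
  have hab' : (ShortComplex.mk a b hab).ShortExact := shortExact_of_lift ma eb (fun k hk => by
    dsimp at k hk ⊢
    have h0 : (k ≫ kernel.ι φ.τ₂) ≫ S.g = 0 := by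
      rw [Category.assoc, ← hb, reassoc_of% hk, zero_comp]
    obtain ⟨l, hl⟩ := exists_lift hS _ h0
    obtain ⟨m, hm⟩ := exists_lift h₁ l (by
      dsimp
      rw [← cancel_mono S'.f, Category.assoc, c₁, reassoc_of% hl, kernel.condition, comp_zero,
        zero_comp])
    dsimp at hm
    refine ⟨m, ?_⟩
    rw [← cancel_mono (kernel.ι φ.τ₂), Category.assoc, ha, reassoc_of% hm, hl])
  have h₂ := hW.mid _ hab' hK₁ hK₃
  have h := hW.mid _ hκ h₂ hm
  exact h

theorem shortExact_cokernel {E A : C} (i : A ⟶ E) [hi : Mono i] :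
    (ShortComplex.mk i (cokernel.π i) (cokernel.condition i)).ShortExact where
  exact := ShortComplex.exact_of_g_is_cokernel _ (cokernelIsCokernel i)
  mono_f := hi
  epi_g := inferInstanceAs (Epi (cokernel.π i))

theorem triv_of_mono {W : ObjectProperty C} (hW : IsThick W) {S S' : ShortComplex C}
    (hS : S.ShortExact) (hS' : S'.ShortExact) (φ : S ⟶ S') {D₁ D₃ : C}
    {p₁ : S'.X₁ ⟶ D₁} {w₁ : φ.τ₁ ≫ p₁ = 0} (h₁ : (ShortComplex.mk φ.τ₁ p₁ w₁).ShortExact)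
    {p₃ : S'.X₃ ⟶ D₃} {w₃ : φ.τ₃ ≫ p₃ = 0} (h₃ : (ShortComplex.mk φ.τ₃ p₃ w₃).ShortExact)
    (hD₁ : W D₁) (hD₃ : W D₃) (hm : W S.X₂) : W S'.X₂ := by
  have := hS.mono_f
  have := hS.epi_g
  have := hS'.mono_f
  have := hS'.epi_g
  have m₁ : Mono φ.τ₁ := h₁.mono_f
  have m₃ : Mono φ.τ₃ := h₃.mono_f
  have e₁ : Epi p₁ := h₁.epi_g
  have e₃ : Epi p₃ := h₃.epi_g
  have m₂ : Mono φ.τ₂ := ShortComplex.mono_τ₂_of_exact_of_mono φ hS.exact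
  have c₁ := φ.comm₁₂
  have c₂ := φ.comm₂₃
  have hκ := shortExact_cokernel φ.τ₂
  obtain ⟨a, ha⟩ := exists_desc h₁ (S'.f ≫ cokernel.π φ.τ₂)
    (by dsimp; rw [reassoc_of% c₁, cokernel.condition, comp_zero])
  obtain ⟨b, hb⟩ := exists_desc hκ (S'.g ≫ p₃)
    (by dsimp; rw [reassoc_of% c₂, w₃, comp_zero])
  dsimp at ha hb
  have hab : a ≫ b = 0 := by
    rw [← cancel_epi p₁, reassoc_of% ha, hb, S'.zero_assoc, zero_comp, comp_zero]
  have eb : Epi b := by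
    have : Epi (cokernel.π φ.τ₂ ≫ b) := by rw [hb]; infer_instance
    exact epi_of_epi (cokernel.π φ.τ₂) b
  have ma : Mono a := by
    refine Preadditive.mono_of_cancel_zero a (fun {T} t ht => ?_)
    obtain ⟨T', π, hπ, y, hy⟩ := surjective_up_to_refinements_of_epi p₁ t
    have h0 : (y ≫ S'.f) ≫ cokernel.π φ.τ₂ = 0 := by
      rw [Category.assoc, ← ha, ← reassoc_of% hy, ht, comp_zero]
    obtain ⟨x, hx⟩ := exists_lift hκ (y ≫ S'.f) h0
    dsimp at hx
    obtain ⟨z, hz⟩ := exists_lift hS x (by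
      rw [← cancel_mono φ.τ₃, Category.assoc, ← c₂, reassoc_of% hx, S'.zero, comp_zero, zero_comp])
    have hzy : z ≫ φ.τ₁ = y := by
      rw [← cancel_mono S'.f, Category.assoc, c₁, reassoc_of% hz, hx]
    rw [← cancel_epi π, hy, ← hzy, Category.assoc, w₁, comp_zero, comp_zero]
  have hab' : (ShortComplex.mk a b hab).ShortExact := shortExact_of_desc ma eb (fun k hk => by
    dsimp at k hk ⊢
    have h0 : S'.f ≫ cokernel.π φ.τ₂ ≫ k = 0 := by
      rw [← reassoc_of% ha, hk, comp_zero]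
    obtain ⟨l, hl⟩ := exists_desc hS' _ h0
    obtain ⟨m, hm⟩ := exists_desc h₃ l (by
      dsimp
      rw [← cancel_epi S.g, ← reassoc_of% c₂, hl, cokernel.condition_assoc, zero_comp, comp_zero])
    dsimp at hm
    refine ⟨m, ?_⟩
    rw [← cancel_epi (cokernel.π φ.τ₂), reassoc_of% hb, hm, hl])
  have h₂ := hW.mid _ hab' hD₁ hD₃
  have h := hW.mid _ hκ hm h₂
  exact h

namespace AbelianModelStructure

variable (M : AbelianModelStructure C)

/-- The core of an abelian model structure. -/
def core : ObjectProperty C := M.cof ⊓ M.triv ⊓ M.fib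

/-- The homotopy relation: the difference factors through an object of the core. -/
def homotopic : HomRel C := fun X Y f g =>
  ∃ (V : C) (a : X ⟶ V) (b : V ⟶ Y), M.core V ∧ a ≫ b = g - f

/-- The stable category of an abelian model structure. -/
abbrev Stable := CategoryTheory.Quotient M.homotopic

/-- The quotient functor to the stable category. -/
abbrev toStable : C ⥤ M.Stable := CategoryTheory.Quotient.functor M.homotopic

/-- A cofibrant replacement sequence `0 ⟶ ker ⟶ QA ⟶ A ⟶ 0`. -/
abbrev CofibrantReplacement (A : C) := SpecialPrecover M.cof (M.triv ⊓ M.fib) A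

/-- A fibrant replacement sequence `0 ⟶ A ⟶ RA ⟶ coker ⟶ 0`. -/
abbrev FibrantReplacement (A : C) := SpecialPreenvelope (M.cof ⊓ M.triv) M.fib A

variable {M}

theorem homotopic_def {X Y : C} {f g : X ⟶ Y} : M.homotopic f g ↔
    ∃ (V : C) (a : X ⟶ V) (b : V ⟶ Y), M.core V ∧ a ≫ b = g - f := Iff.rfl

theorem cof_mid {S : ShortComplex C} (hS : S.ShortExact) (h₁ : M.cof S.X₁) (h₃ : M.cof S.X₃) :
    M.cof S.X₂ := (M.left_cotorsion.left _).2 (fun B hB =>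
  ext_mid_left hS ((M.left_cotorsion.left _).1 h₁ B hB) ((M.left_cotorsion.left _).1 h₃ B hB))

theorem fib_mid {S : ShortComplex C} (hS : S.ShortExact) (h₁ : M.fib S.X₁) (h₃ : M.fib S.X₃) :
    M.fib S.X₂ := (M.right_cotorsion.right _).2 (fun B hB =>
  ext_mid_right hS ((M.right_cotorsion.right _).1 h₁ B hB) ((M.right_cotorsion.right _).1 h₃ B hB))

theorem core_mid {S : ShortComplex C} (hS : S.ShortExact) (h₁ : M.core S.X₁) (h₃ : M.core S.X₃) :
    M.core S.X₂ :=
  ⟨⟨cof_mid hS h₁.1.1 h₃.1.1, M.thick.mid _ hS h₁.1.2 h₃.1.2⟩, fib_mid hS h₁.2 h₃.2⟩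

theorem core_zero {Z : C} (hZ : IsZero Z) : M.core Z :=
  ⟨(M.right_cotorsion.left _).2 (fun _ _ => subsingleton_of_isZero hZ),
    (M.right_cotorsion.right _).2 (fun _ _ => subsingleton_of_isZero' hZ)⟩

/-- `Ext¹(cofibrant, trivially fibrant) = 0` -/
theorem ext_left {X Y : C} (hX : M.cof X) (hY : (M.triv ⊓ M.fib) Y) : Subsingleton (YExt X Y 1) :=
  (M.left_cotorsion.left _).1 hX _ hY

/-- `Ext¹(trivially cofibrant, fibrant) = 0` -/
theorem ext_right {X Y : C} (hX : (M.cof ⊓ M.triv) X) (hY : M.fib Y) : Subsingleton (YExt X Y 1) :=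
  (M.right_cotorsion.left _).1 hX _ hY

theorem homotopic_add {X Y : C} {f f' g g' : X ⟶ Y} (hf : M.homotopic f f')
    (hg : M.homotopic g g') : M.homotopic (f + g) (f' + g') := by
  obtain ⟨V, a, b, hV, h⟩ := hf
  obtain ⟨V', a', b', hV', h'⟩ := hg
  refine ⟨V ⊞ V', biprod.lift a a', biprod.desc b b', core_mid (shortExact_inl_snd V V') hV hV', ?_⟩
  rw [biprod.lift_desc, h, h']
  abel

theorem homotopic_refl {X Y : C} (f : X ⟶ Y) : M.homotopic f f :=
  by
  obtain ⟨Z, hZ⟩ := HasZeroObject.zero (C := C)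
  exact ⟨Z, 0, 0, core_zero hZ, by simp⟩

theorem homotopic_neg {X Y : C} {f f' : X ⟶ Y} (hf : M.homotopic f f') :
    M.homotopic (-f) (-f') := by
  obtain ⟨V, a, b, hV, h⟩ := hf
  exact ⟨V, a, -b, hV, by rw [Preadditive.comp_neg, h]; abel⟩

theorem homotopic_iff_sub {X Y : C} {f g : X ⟶ Y} : M.homotopic f g ↔ M.homotopic 0 (g - f) := by
  simp only [homotopic_def, sub_zero]

instance : Congruence M.homotopic where
  comp_left f g g' h := by
    obtain ⟨V, a, b, hV, h⟩ := h
    exact ⟨V, f ≫ a, b, hV, by rw [Category.assoc, h, Preadditive.comp_sub]⟩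
  comp_right g h := by
    obtain ⟨V, a, b, hV, h⟩ := h
    exact ⟨V, a, b ≫ g, hV, by rw [← Category.assoc, h, Preadditive.sub_comp]⟩
  equivalence := 
    { refl := homotopic_refl
      symm := fun {f g} h => by
        have := homotopic_neg h
        rw [homotopic_iff_sub] at this ⊢
        convert this using 1
        abel
      trans := fun {f g k} h h' => by
        rw [homotopic_iff_sub] at h h' ⊢
        have := homotopic_add h h'
        simpa using this }

noncomputable instance : Preadditive M.Stable :=
  CategoryTheory.Quotient.preadditive _ (fun _ _ _ _ _ _ => homotopic_add)

theorem toStable_map_eq_iff {X Y : C} (f g : X ⟶ Y) :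
    M.toStable.map f = M.toStable.map g ↔ M.homotopic f g :=
  CategoryTheory.Quotient.functor_map_eq_iff _ f g

theorem toStable_map_surjective {X Y : C} (φ : M.toStable.obj X ⟶ M.toStable.obj Y) :
    ∃ f : X ⟶ Y, M.toStable.map f = φ :=
  (CategoryTheory.Quotient.functor M.homotopic).map_surjective φ

/-- A morphism from a cofibrant object that factors through a trivially fibrant object factors
through the core. -/
theorem factors_of_cof {X V Y : C} (hX : M.cof X) (hV : (M.triv ⊓ M.fib) V) (a : X ⟶ V) (b : V ⟶ Y) :
    ∃ (V' : C) (a' : X ⟶ V') (b' : V' ⟶ Y), M.core V' ∧ a' ≫ b' = a ≫ b := by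
  obtain ⟨P⟩ := M.left_complete.enoughProjectives V
  obtain ⟨l, hl⟩ := lift_of_ext P.shortExact (ext_left hX P.mem_ker) a
  dsimp at l hl
  refine ⟨P.obj, l, P.π ≫ b, ⟨⟨P.mem, M.thick.mid _ P.shortExact P.mem_ker.1 hV.1⟩,
    fib_mid P.shortExact P.mem_ker.2 hV.2⟩, by rw [reassoc_of% hl]⟩

/-- A morphism to a fibrant object that factors through a trivially cofibrant object factors
through the core. -/
theorem factors_of_fib {X V Y : C} (hY : M.fib Y) (hV : (M.cof ⊓ M.triv) V) (a : X ⟶ V) (b : V ⟶ Y) :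
    ∃ (V' : C) (a' : X ⟶ V') (b' : V' ⟶ Y), M.core V' ∧ a' ≫ b' = a ≫ b := by
  obtain ⟨P⟩ := M.right_complete.enoughInjectives V
  obtain ⟨l, hl⟩ := extend_of_ext P.shortExact (ext_right P.mem_coker hY) b
  dsimp at l hl
  refine ⟨P.obj, a ≫ P.ι, l, ⟨⟨cof_mid P.shortExact hV.1 P.mem_coker.1,
    M.thick.mid _ P.shortExact hV.2 P.mem_coker.2⟩, P.mem⟩, by rw [Category.assoc, hl]⟩

variable (M) in
/-- A choice of cofibrant and fibrant replacements of all objects. -/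
structure Replacements where
  cofRep : ∀ A : C, M.CofibrantReplacement A
  fibRep : ∀ A : C, M.FibrantReplacement A

namespace Replacements

variable (r : M.Replacements)

/-- the cofibrant replacement `QA` -/
abbrev Q (A : C) : C := (r.cofRep A).obj

/-- the fibrant replacement `RA` -/
abbrev R (A : C) : C := (r.fibRep A).obj

/-- the epimorphism `QA ⟶ A` -/
abbrev p (A : C) : r.Q A ⟶ A := (r.cofRep A).π

/-- the monomorphism `A ⟶ RA` -/
abbrev j (A : C) : A ⟶ r.R A := (r.fibRep A).ι

/-- the bifibrant replacement `RQA` -/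
abbrev RQ (A : C) : C := r.R (r.Q A)

theorem cof_Q (A : C) : M.cof (r.Q A) := (r.cofRep A).mem

theorem fib_R (A : C) : M.fib (r.R A) := (r.fibRep A).mem

theorem cof_RQ (A : C) : M.cof (r.RQ A) :=
  cof_mid (r.fibRep (r.Q A)).shortExact (r.cof_Q A) (r.fibRep (r.Q A)).mem_coker.1

theorem exists_mapQ {A B : C} (f : A ⟶ B) : ∃ g : r.Q A ⟶ r.Q B, g ≫ r.p B = r.p A ≫ f :=
  lift_of_ext (r.cofRep B).shortExact (ext_left (r.cof_Q A) (r.cofRep B).mem_ker) _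

theorem exists_mapR {A B : C} (f : A ⟶ B) : ∃ g : r.R A ⟶ r.R B, r.j A ≫ g = f ≫ r.j B :=
  extend_of_ext (r.fibRep A).shortExact (ext_right (r.fibRep A).mem_coker (r.fib_R B)) _

/-- A choice of `Q(f)`, a morphism `QA ⟶ QB` over `f : A ⟶ B`. -/
noncomputable def mapQ {A B : C} (f : A ⟶ B) : r.Q A ⟶ r.Q B := (r.exists_mapQ f).choose

/-- A choice of `R(f)`, a morphism `RA ⟶ RB` under `f : A ⟶ B`. -/
noncomputable def mapR {A B : C} (f : A ⟶ B) : r.R A ⟶ r.R B := (r.exists_mapR f).choose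

theorem mapQ_p {A B : C} (f : A ⟶ B) : r.mapQ f ≫ r.p B = r.p A ≫ f := (r.exists_mapQ f).choose_spec

theorem j_mapR {A B : C} (f : A ⟶ B) : r.j A ≫ r.mapR f = f ≫ r.j B := (r.exists_mapR f).choose_spec

theorem homotopic_of_p {A X : C} (hX : M.cof X) {g g' : X ⟶ r.Q A} (h : g ≫ r.p A = g' ≫ r.p A) :
    M.homotopic g g' := by
  obtain ⟨l, hl⟩ := exists_lift (r.cofRep A).shortExact (g' - g)
    ((Preadditive.sub_comp _ _ _).trans (sub_eq_zero.2 h.symm))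
  obtain ⟨V, a, b, hV, hab⟩ := factors_of_cof hX (r.cofRep A).mem_ker l (r.cofRep A).ι
  exact ⟨V, a, b, hV, hab.trans hl⟩

theorem homotopic_of_j {A Y : C} (hY : M.fib Y) {g g' : r.R A ⟶ Y} (h : r.j A ≫ g = r.j A ≫ g') :
    M.homotopic g g' := by
  obtain ⟨l, hl⟩ := exists_desc (r.fibRep A).shortExact (g' - g)
    ((Preadditive.comp_sub _ _ _).trans (sub_eq_zero.2 h.symm))
  obtain ⟨V, a, b, hV, hab⟩ := factors_of_fib hY (r.fibRep A).mem_coker (r.fibRep A).π l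
  exact ⟨V, a, b, hV, hab.trans hl⟩

/-- `R` respects the homotopy relation. -/
theorem homotopic_mapR {A B : C} {q q' : A ⟶ B} (h : M.homotopic q q') {s s' : r.R A ⟶ r.R B}
    (hs : r.j A ≫ s = q ≫ r.j B) (hs' : r.j A ≫ s' = q' ≫ r.j B) : M.homotopic s s' := by
  obtain ⟨V, a, b, hV, h⟩ := h
  obtain ⟨a', ha'⟩ : ∃ a' : r.R A ⟶ V, r.j A ≫ a' = a := extend_of_ext (r.fibRep A).shortExact
    (ext_right (r.fibRep A).mem_coker hV.2) a
  have h1 : M.homotopic s (s + a' ≫ b ≫ r.j B) := ⟨V, a', b ≫ r.j B, hV, by abel⟩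
  refine Congruence.equivalence.trans h1 (r.homotopic_of_j (r.fib_R B) ?_)
  rw [Preadditive.comp_add, hs, reassoc_of% ha', reassoc_of% h, hs', Preadditive.sub_comp]
  abel

variable (M) in
theorem nonempty : Nonempty M.Replacements :=
  ⟨⟨fun A => (M.left_complete.enoughProjectives A).some,
    fun A => (M.right_complete.enoughInjectives A).some⟩⟩

/-- The homotopy category `Ho(M)`: the objects are those of the ground category, and the morphisms
from `A` to `B` are the homotopy classes of morphisms from `RQA` to `RQB`. -/
abbrev Ho := InducedCategory M.Stable (fun A : C => M.toStable.obj (r.RQ A))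

/-- The morphism `A ⟶ B` in `Ho(M)` given by the homotopy class of a morphism `RQA ⟶ RQB`. -/
def hoMk {A B : C} (f : r.RQ A ⟶ r.RQ B) : @Quiver.Hom r.Ho _ A B :=
  InducedCategory.homMk (M.toStable.map f)

theorem hoMk_eq_iff {A B : C} {f g : r.RQ A ⟶ r.RQ B} :
    r.hoMk f = r.hoMk g ↔ M.homotopic f g := by
  rw [← toStable_map_eq_iff]
  exact ⟨fun h => congrArg (fun φ : @Quiver.Hom r.Ho _ A B => φ.hom) h, fun h => InducedCategory.hom_ext h⟩

theorem hoMk_surjective {A B : r.Ho} (φ : A ⟶ B) :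
    ∃ f : r.RQ A ⟶ r.RQ B, r.hoMk (A := A) (B := B) f = φ := by
  obtain ⟨f, hf⟩ := toStable_map_surjective φ.hom
  exact ⟨f, InducedCategory.hom_ext hf⟩

theorem hoMk_id (A : C) : r.hoMk (𝟙 (r.RQ A)) = 𝟙 (show r.Ho from A) :=
  InducedCategory.hom_ext (M.toStable.map_id _)

theorem hoMk_comp {A B D : C} (f : r.RQ A ⟶ r.RQ B) (g : r.RQ B ⟶ r.RQ D) :
    r.hoMk (f ≫ g) = r.hoMk f ≫ r.hoMk g :=
  InducedCategory.hom_ext (M.toStable.map_comp _ _)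

/-- A choice of `R(Q(f))`. -/
noncomputable abbrev mapRQ {A B : C} (f : A ⟶ B) : r.RQ A ⟶ r.RQ B := r.mapR (r.mapQ f)

theorem mapQ_id (A : C) : M.homotopic (r.mapQ (𝟙 A)) (𝟙 _) :=
  r.homotopic_of_p (r.cof_Q A) (by rw [mapQ_p]; simp)

theorem mapQ_comp {A B D : C} (f : A ⟶ B) (g : B ⟶ D) :
    M.homotopic (r.mapQ (f ≫ g)) (r.mapQ f ≫ r.mapQ g) :=
  r.homotopic_of_p (r.cof_Q A) (by
    rw [mapQ_p, Category.assoc, mapQ_p, ← Category.assoc, ← Category.assoc, mapQ_p])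

theorem mapR_id (A : C) : M.homotopic (r.mapR (𝟙 A)) (𝟙 _) :=
  r.homotopic_of_j (r.fib_R A) (by rw [j_mapR]; simp)

theorem mapR_comp {A B D : C} (f : A ⟶ B) (g : B ⟶ D) :
    M.homotopic (r.mapR (f ≫ g)) (r.mapR f ≫ r.mapR g) :=
  r.homotopic_of_j (r.fib_R D) (by
    rw [j_mapR, ← Category.assoc (r.j A), j_mapR, Category.assoc, Category.assoc, j_mapR])

theorem mapRQ_id (A : C) : M.homotopic (r.mapRQ (𝟙 A)) (𝟙 _) :=
  r.homotopic_mapR (r.mapQ_id A) (r.j_mapR _) (by simp)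

theorem mapRQ_comp {A B D : C} (f : A ⟶ B) (g : B ⟶ D) :
    M.homotopic (r.mapRQ (f ≫ g)) (r.mapRQ f ≫ r.mapRQ g) :=
  r.homotopic_mapR (r.mapQ_comp f g) (r.j_mapR _) (by
    rw [← Category.assoc, j_mapR, Category.assoc, j_mapR, Category.assoc])

/-- The canonical functor `γ` from the ground category to `Ho(M)`. -/
noncomputable def γ : C ⥤ r.Ho where
  obj A := A
  map f := r.hoMk (r.mapRQ f)
  map_id A := (r.hoMk_eq_iff.2 (r.mapRQ_id A)).trans (r.hoMk_id A)
  map_comp f g := (r.hoMk_eq_iff.2 (r.mapRQ_comp f g)).trans (r.hoMk_comp _ _)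

end Replacements

end AbelianModelStructure

/-! ### Loops and suspensions -/

/-- `T` and `T'` are connected by a morphism of short complexes which is `k` on the left and `f` on
the right. -/
def Connects (T T' : ShortComplex C) (k : T.X₁ ⟶ T'.X₁) (f : T.X₃ ⟶ T'.X₃) : Prop :=
  ∃ φ : T ⟶ T', φ.τ₁ = k ∧ φ.τ₃ = f

theorem Connects.id (T : ShortComplex C) : Connects T T (𝟙 _) (𝟙 _) := ⟨𝟙 T, rfl, rfl⟩

theorem Connects.comp {T T' T'' : ShortComplex C} {k : T.X₁ ⟶ T'.X₁} {f : T.X₃ ⟶ T'.X₃}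
    {k' : T'.X₁ ⟶ T''.X₁} {f' : T'.X₃ ⟶ T''.X₃} (h : Connects T T' k f)
    (h' : Connects T' T'' k' f') : Connects T T'' (k ≫ k') (f ≫ f') := by
  obtain ⟨φ, rfl, rfl⟩ := h
  obtain ⟨φ', rfl, rfl⟩ := h'
  exact ⟨φ ≫ φ', rfl, rfl⟩

namespace AbelianModelStructure

variable {M : AbelianModelStructure C}

section

variable {T T' : ShortComplex C} (hT : T.ShortExact) (hT' : T'.ShortExact)

theorem exists_connects_left (hm : M.core T.X₂) (h' : M.fib T'.X₁) (f : T.X₃ ⟶ T'.X₃)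
    (hT' : T'.ShortExact) : ∃ k, Connects T T' k f := by
  obtain ⟨g, hg⟩ := lift_of_ext hT' (ext_right hm.1 h') (T.g ≫ f)
  obtain ⟨k, hk⟩ := exists_lift hT' (T.f ≫ g) (by rw [Category.assoc, hg, T.zero_assoc, zero_comp])
  exact ⟨k, { τ₁ := k, τ₂ := g, τ₃ := f, comm₁₂ := hk, comm₂₃ := hg }, rfl, rfl⟩

theorem exists_connects_right (hm : M.core T'.X₂) (h : M.cof T.X₃) (k : T.X₁ ⟶ T'.X₁)
    (hT : T.ShortExact) : ∃ f, Connects T T' k f := by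
  obtain ⟨g, hg⟩ := extend_of_ext hT (ext_left h ⟨hm.1.2, hm.2⟩) (k ≫ T'.f)
  obtain ⟨f, hf⟩ := exists_desc hT (g ≫ T'.g) (by
    rw [reassoc_of% hg, T'.zero, comp_zero])
  exact ⟨f, { τ₁ := k, τ₂ := g, τ₃ := f, comm₁₂ := hg.symm, comm₂₃ := hf.symm }, rfl, rfl⟩

theorem homotopic_left (hm : M.core T.X₂) (h' : M.fib T'.X₁) (hT' : T'.ShortExact)
    {k k' : T.X₁ ⟶ T'.X₁} {f f' : T.X₃ ⟶ T'.X₃} (h₁ : Connects T T' k f)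
    (h₂ : Connects T T' k' f') (hf : M.homotopic f f') : M.homotopic k k' := by
  obtain ⟨φ, rfl, rfl⟩ := h₁
  obtain ⟨φ', rfl, rfl⟩ := h₂
  obtain ⟨V, a, b, hV, hab⟩ := hf
  obtain ⟨b', hb'⟩ := lift_of_ext hT' (ext_right hV.1 h') b
  obtain ⟨m, hm'⟩ := exists_lift hT' (φ'.τ₂ - φ.τ₂ - T.g ≫ a ≫ b') (by
    simp only [Preadditive.sub_comp, Category.assoc, hb', hab, φ.comm₂₃, φ'.comm₂₃,
      Preadditive.comp_sub, sub_self])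
  refine ⟨T.X₂, T.f, m, hm, ?_⟩
  have := hT'.mono_f
  rw [← cancel_mono T'.f, Category.assoc, hm']
  simp only [Preadditive.comp_sub, Preadditive.sub_comp, T.zero_assoc, zero_comp, sub_zero,
    φ.comm₁₂, φ'.comm₁₂]

theorem homotopic_right (hm : M.core T'.X₂) (h : M.cof T.X₃) (hT : T.ShortExact)
    {k k' : T.X₁ ⟶ T'.X₁} {f f' : T.X₃ ⟶ T'.X₃} (h₁ : Connects T T' k f)
    (h₂ : Connects T T' k' f') (hk : M.homotopic k k') : M.homotopic f f' := by
  obtain ⟨φ, rfl, rfl⟩ := h₁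
  obtain ⟨φ', rfl, rfl⟩ := h₂
  obtain ⟨V, a, b, hV, hab⟩ := hk
  obtain ⟨a', ha'⟩ := extend_of_ext hT (ext_left h ⟨hV.1.2, hV.2⟩) a
  obtain ⟨m, hm'⟩ := exists_desc hT (φ'.τ₂ - φ.τ₂ - a' ≫ b ≫ T'.f) (by
    simp only [Preadditive.comp_sub, reassoc_of% ha', reassoc_of% hab, φ.comm₁₂, φ'.comm₁₂,
      Preadditive.sub_comp, sub_self])
  refine ⟨T'.X₂, m, T'.g, hm, ?_⟩
  have := hT.epi_g
  rw [← cancel_epi T.g, reassoc_of% hm']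
  simp only [Preadditive.comp_sub, Preadditive.sub_comp, T'.zero, comp_zero, sub_zero,
    φ.comm₂₃, φ'.comm₂₃, Category.assoc]

end

/-- A bifibrant approximation sequence of a short exact sequence `S : 0 ⟶ X ⟶ W ⟶ Y ⟶ 0`: a
commutative diagram with exact rows `RQX ⟶ RQW ⟶ RQY`, `QX ⟶ QW ⟶ QY` and `X ⟶ W ⟶ Y`. -/
structure BifibrantApproximation (r : M.Replacements) (S : ShortComplex C) where
  {qMid rqMid : C}
  qf : r.Q S.X₁ ⟶ qMid
  qg : qMid ⟶ r.Q S.X₃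
  qzero : qf ≫ qg = 0
  q_shortExact : (ShortComplex.mk qf qg qzero).ShortExact
  rqf : r.RQ S.X₁ ⟶ rqMid
  rqg : rqMid ⟶ r.RQ S.X₃
  rqzero : rqf ≫ rqg = 0
  rq_shortExact : (ShortComplex.mk rqf rqg rqzero).ShortExact
  down : qMid ⟶ S.X₂
  down_left : qf ≫ down = r.p S.X₁ ≫ S.f
  down_right : down ≫ S.g = qg ≫ r.p S.X₃
  up : qMid ⟶ rqMid
  up_left : qf ≫ up = r.j (r.Q S.X₁) ≫ rqf
  up_right : up ≫ rqg = qg ≫ r.j (r.Q S.X₃)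

namespace BifibrantApproximation

variable {r : M.Replacements} {S : ShortComplex C}

/-- The top row `RQX ⟶ RQW ⟶ RQY`. -/
abbrev top (a : BifibrantApproximation r S) : ShortComplex C :=
  ShortComplex.mk a.rqf a.rqg a.rqzero

theorem core_top (hS : S.ShortExact) (hW : M.triv S.X₂) (a : BifibrantApproximation r S) :
    M.core a.rqMid := by
  let φ : ShortComplex.mk a.qf a.qg a.qzero ⟶ S :=
    { τ₁ := r.p _, τ₂ := a.down, τ₃ := r.p _, comm₁₂ := a.down_left.symm, comm₂₃ := a.down_right }
  let ψ : ShortComplex.mk a.qf a.qg a.qzero ⟶ a.top :=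
    { τ₁ := r.j _, τ₂ := a.up, τ₃ := r.j _, comm₁₂ := a.up_left.symm, comm₂₃ := a.up_right }
  have h₁ : M.triv a.qMid := triv_of_epi M.thick a.q_shortExact hS φ
    (r.cofRep S.X₁).shortExact (r.cofRep S.X₃).shortExact (r.cofRep S.X₁).mem_ker.1
    (r.cofRep S.X₃).mem_ker.1 hW
  have h₂ : M.triv a.rqMid := triv_of_mono M.thick a.q_shortExact a.rq_shortExact ψ
    (r.fibRep _).shortExact (r.fibRep _).shortExact (r.fibRep _).mem_coker.2
    (r.fibRep _).mem_coker.2 h₁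
  exact ⟨⟨cof_mid a.rq_shortExact (r.cof_RQ _) (r.cof_RQ _), h₂⟩,
    fib_mid a.rq_shortExact (r.fib_R _) (r.fib_R _)⟩

end BifibrantApproximation

end AbelianModelStructure

section horseshoe

open Abelian

attribute [local instance] hasExt

theorem exists_shortExact {A B : C} (x : Ext.{max u v} A B 1) :
    ∃ (E : C) (i : B ⟶ E) (p : E ⟶ A) (w : i ≫ p = 0)
      (h : (ShortComplex.mk i p w).ShortExact), h.extClass = x := by
  obtain ⟨e, he⟩ := NExt.cls_surjective x
  cases e with
  | single i p w h => exact ⟨_, i, p, w, h, he⟩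

theorem nonempty_bifibrantApproximation (M : HereditaryModelStructure C)
    (r : M.toAbelianModelStructure.Replacements) {S : ShortComplex C} (hS : S.ShortExact) :
    Nonempty (AbelianModelStructure.BifibrantApproximation r S) := by
  have v₁ : Subsingleton (YExt (r.Q S.X₃) (r.cofRep S.X₁).ker 2) :=
    M.left_hereditary _ _ (r.cof_Q _) (r.cofRep S.X₁).mem_ker 2 (by omega)
  have v₂ : Subsingleton (YExt (r.fibRep (r.Q S.X₃)).coker (r.RQ S.X₁) 2) :=
    M.right_hereditary _ _ (r.fibRep (r.Q S.X₃)).mem_coker (r.fib_R _) 2 (by omega)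
  obtain ⟨x, hx⟩ := Ext.covariant_sequence_exact₃ (r.Q S.X₃) (r.cofRep S.X₁).shortExact
    ((Ext.mk₀ (r.p S.X₃)).comp hS.extClass (zero_add 1)) (n₁ := 2) rfl (YExt.ext_eq_zero _)
  obtain ⟨E, qf, qg, qw, hq, rfl⟩ := exists_shortExact x
  obtain ⟨y, hy⟩ := Ext.contravariant_sequence_exact₁ (r.fibRep (r.Q S.X₃)).shortExact (r.RQ S.X₁)
    (hq.extClass.comp (Ext.mk₀ (r.j (r.Q S.X₁))) (add_zero 1)) (n₁ := 2) rfl (YExt.ext_eq_zero _)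
  obtain ⟨E', rf, rg, rw', hr, rfl⟩ := exists_shortExact y
  obtain ⟨d, hd₁, hd₂⟩ := exists_mid hq hS (r.p S.X₁) (r.p S.X₃) hx
  obtain ⟨t, ht₁, ht₂⟩ := exists_mid hq hr (r.j _) (r.j _) hy.symm
  exact ⟨⟨qf, qg, qw, hq, rf, rg, rw', hr, d, hd₁, hd₂, t, ht₁, ht₂⟩⟩

end horseshoe

namespace HereditaryModelStructure

variable (M : HereditaryModelStructure C)

/-- A choice of cofibrant and fibrant replacements. -/
abbrev Replacements := M.toAbelianModelStructure.Replacements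

/-- A short exact sequence `0 ⟶ ΩA ⟶ W ⟶ A ⟶ 0` with `W` trivial. -/
structure LoopSequence (A : C) where
  {loop mid : C}
  ι : loop ⟶ mid
  π : mid ⟶ A
  w : ι ≫ π = 0
  shortExact : (ShortComplex.mk ι π w).ShortExact
  mem : M.triv mid

/-- A short exact sequence `0 ⟶ A ⟶ W ⟶ ΣA ⟶ 0` with `W` trivial. -/
structure SuspensionSequence (A : C) where
  {mid susp : C}
  ι : A ⟶ mid
  π : mid ⟶ susp
  w : ι ≫ π = 0
  shortExact : (ShortComplex.mk ι π w).ShortExact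
  mem : M.triv mid

theorem LoopSequence.nonempty (A : C) : Nonempty (M.LoopSequence A) :=
  have ⟨P⟩ := M.right_complete.enoughProjectives A
  ⟨⟨P.ι, P.π, P.w, P.shortExact, P.mem.2⟩⟩

theorem SuspensionSequence.nonempty (A : C) : Nonempty (M.SuspensionSequence A) :=
  have ⟨P⟩ := M.left_complete.enoughInjectives A
  ⟨⟨P.ι, P.π, P.w, P.shortExact, P.mem.1⟩⟩

variable {M} (r : M.Replacements)

open AbelianModelStructure Replacements

section loop

variable (ℓ : ∀ A, M.LoopSequence A)

/-- A choice of a bifibrant approximation sequence of `0 ⟶ ΩA ⟶ W ⟶ A ⟶ 0`. -/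
noncomputable def loopApprox (A : C) :
    BifibrantApproximation r (ShortComplex.mk (ℓ A).ι (ℓ A).π (ℓ A).w) :=
  (nonempty_bifibrantApproximation M r (ℓ A).shortExact).some

/-- The sequence `0 ⟶ RQΩA ⟶ RQW ⟶ RQA ⟶ 0`. -/
noncomputable abbrev loopTop (A : C) : ShortComplex C := (loopApprox r ℓ A).top

theorem core_loopTop (A : C) : M.core (loopTop r ℓ A).X₂ :=
  (loopApprox r ℓ A).core_top (ℓ A).shortExact (ℓ A).mem

theorem exists_loop {A B : C} (f : r.RQ A ⟶ r.RQ B) :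
    ∃ k : r.RQ (ℓ A).loop ⟶ r.RQ (ℓ B).loop, Connects (loopTop r ℓ A) (loopTop r ℓ B) k f :=
  exists_connects_left (T := loopTop r ℓ A) (T' := loopTop r ℓ B)
    (core_loopTop r ℓ A) (r.fib_R _) f (loopApprox r ℓ B).rq_shortExact

theorem exists_loop_hom {A B : r.Ho} (φ : A ⟶ B) :
    ∃ (f : r.RQ A ⟶ r.RQ B) (k : r.RQ (ℓ A).loop ⟶ r.RQ (ℓ B).loop),
      r.hoMk f = φ ∧ Connects (loopTop r ℓ A) (loopTop r ℓ B) k f := by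
  obtain ⟨f, hf⟩ := r.hoMk_surjective φ
  obtain ⟨k, hk⟩ := exists_loop r ℓ f
  exact ⟨f, k, hf, hk⟩

/-- The loop functor on morphisms: the homotopy class of `f : RQA ⟶ RQB` is sent to the homotopy
class of `k : RQΩA ⟶ RQΩB` whenever `k` and `f` extend to a morphism of the bifibrant approximation
sequences. -/
noncomputable def loopMap {A B : r.Ho} (φ : A ⟶ B) :
    @Quiver.Hom r.Ho _ (ℓ A).loop (ℓ B).loop :=
  r.hoMk (exists_loop_hom r ℓ φ).choose_spec.choose

theorem loopMap_eq {A B : C} (f : r.RQ A ⟶ r.RQ B) (k : r.RQ (ℓ A).loop ⟶ r.RQ (ℓ B).loop)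
    (h : Connects (loopTop r ℓ A) (loopTop r ℓ B) k f) :
    loopMap r ℓ (r.hoMk f) = r.hoMk k := by
  have H := (exists_loop_hom r ℓ (r.hoMk f)).choose_spec.choose_spec
  exact r.hoMk_eq_iff.2 (homotopic_left (core_loopTop r ℓ A) (r.fib_R _)
    (loopApprox r ℓ B).rq_shortExact H.2 h (r.hoMk_eq_iff.1 H.1))

/-- The loop functor `Ω : Ho(M) ⥤ Ho(M)`. -/
noncomputable def loopFunctor : r.Ho ⥤ r.Ho where
  obj A := (ℓ A).loop
  map φ := loopMap r ℓ φ
  map_id A := by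
    rw [← r.hoMk_id A]
    exact (loopMap_eq r ℓ _ _ (Connects.id _)).trans (r.hoMk_id _)
  map_comp {A B D} φ ψ := by
    obtain ⟨f, rfl⟩ := r.hoMk_surjective φ
    obtain ⟨g, rfl⟩ := r.hoMk_surjective ψ
    obtain ⟨k, hk⟩ := exists_loop r ℓ f
    obtain ⟨l, hl⟩ := exists_loop r ℓ g
    rw [loopMap_eq r ℓ f k hk, loopMap_eq r ℓ g l hl, ← r.hoMk_comp,
      loopMap_eq r ℓ (f ≫ g) (k ≫ l) (hk.comp hl)]
    exact r.hoMk_comp _ _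

end loop

section suspension

variable (s : ∀ A, M.SuspensionSequence A)

/-- A choice of a bifibrant approximation sequence of `0 ⟶ A ⟶ W ⟶ ΣA ⟶ 0`. -/
noncomputable def suspApprox (A : C) :
    BifibrantApproximation r (ShortComplex.mk (s A).ι (s A).π (s A).w) :=
  (nonempty_bifibrantApproximation M r (s A).shortExact).some

/-- The sequence `0 ⟶ RQA ⟶ RQW ⟶ RQΣA ⟶ 0`. -/
noncomputable abbrev suspTop (A : C) : ShortComplex C := (suspApprox r s A).top

theorem core_suspTop (A : C) : M.core (suspTop r s A).X₂ :=
  (suspApprox r s A).core_top (s A).shortExact (s A).mem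

theorem exists_susp {A B : C} (k : r.RQ A ⟶ r.RQ B) :
    ∃ f : r.RQ (s A).susp ⟶ r.RQ (s B).susp, Connects (suspTop r s A) (suspTop r s B) k f :=
  exists_connects_right (T := suspTop r s A) (T' := suspTop r s B)
    (core_suspTop r s B) (r.cof_RQ _) k (suspApprox r s A).rq_shortExact

theorem exists_susp_hom {A B : r.Ho} (φ : A ⟶ B) :
    ∃ (k : r.RQ A ⟶ r.RQ B) (f : r.RQ (s A).susp ⟶ r.RQ (s B).susp),
      r.hoMk k = φ ∧ Connects (suspTop r s A) (suspTop r s B) k f := by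
  obtain ⟨f, hf⟩ := r.hoMk_surjective φ
  obtain ⟨k, hk⟩ := exists_susp r s f
  exact ⟨f, k, hf, hk⟩

/-- The suspension functor on morphisms: the homotopy class of `k : RQA ⟶ RQB` is sent to the
homotopy class of `f : RQΣA ⟶ RQΣB` whenever `k` and `f` extend to a morphism of the bifibrant
approximation sequences. -/
noncomputable def suspMap {A B : r.Ho} (φ : A ⟶ B) :
    @Quiver.Hom r.Ho _ (s A).susp (s B).susp :=
  r.hoMk (exists_susp_hom r s φ).choose_spec.choose

theorem suspMap_eq {A B : C} (k : r.RQ A ⟶ r.RQ B) (f : r.RQ (s A).susp ⟶ r.RQ (s B).susp)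
    (h : Connects (suspTop r s A) (suspTop r s B) k f) :
    suspMap r s (r.hoMk k) = r.hoMk f := by
  have H := (exists_susp_hom r s (r.hoMk k)).choose_spec.choose_spec
  exact r.hoMk_eq_iff.2 (homotopic_right (core_suspTop r s B) (r.cof_RQ _)
    (suspApprox r s A).rq_shortExact H.2 h (r.hoMk_eq_iff.1 H.1))

/-- The suspension functor `Σ : Ho(M) ⥤ Ho(M)`. -/
noncomputable def suspFunctor : r.Ho ⥤ r.Ho where
  obj A := (s A).susp
  map φ := suspMap r s φ
  map_id A := by
    rw [← r.hoMk_id A]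
    exact (suspMap_eq r s _ _ (Connects.id _)).trans (r.hoMk_id _)
  map_comp {A B D} φ ψ := by
    obtain ⟨f, rfl⟩ := r.hoMk_surjective φ
    obtain ⟨g, rfl⟩ := r.hoMk_surjective ψ
    obtain ⟨k, hk⟩ := exists_susp r s f
    obtain ⟨l, hl⟩ := exists_susp r s g
    rw [suspMap_eq r s f k hk, suspMap_eq r s g l hl, ← r.hoMk_comp,
      suspMap_eq r s (f ≫ g) (k ≫ l) (hk.comp hl)]
    exact r.hoMk_comp _ _

end suspension

end HereditaryModelStructure

namespace HereditaryModelStructure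

variable {M : HereditaryModelStructure C} (r : M.Replacements)

open AbelianModelStructure Replacements Opposite

/-! ### The Ext functors and the morphism functors -/

/-- `Extⁿ(X, -)` is homotopy invariant if `X` is cofibrant and `n ≥ 1`. -/
theorem push_eq {X Y Y' : C} (hX : M.cof X) {g g' : Y ⟶ Y'} (h : M.homotopic g g') {n : ℕ}
    (hn : 1 ≤ n) (x : YExt X Y n) : YExt.push g x = YExt.push g' x := by
  obtain ⟨V, a, b, hV, hab⟩ := h
  have := push_eq_zero a b (M.left_hereditary X V hX ⟨hV.1.2, hV.2⟩ n hn) x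
  rw [hab, YExt.push_sub] at this
  exact (sub_eq_zero.1 this).symm

/-- `Extⁿ(-, Y)` is homotopy invariant if `Y` is fibrant and `n ≥ 1`. -/
theorem pull_eq {X X' Y : C} (hY : M.fib Y) {f f' : X ⟶ X'} (h : M.homotopic f f') {n : ℕ}
    (hn : 1 ≤ n) (x : YExt X' Y n) : YExt.pull f x = YExt.pull f' x := by
  obtain ⟨V, a, b, hV, hab⟩ := h
  have := pull_eq_zero a b (M.right_hereditary V Y hV.1 hY n hn) x
  rw [hab, YExt.pull_sub] at this
  exact (sub_eq_zero.1 this).symm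

/-- The functor `(A, B) ↦ Extⁿ(RQA, RQB)` for `n ≥ 1`. -/
noncomputable def hoExt (n : ℕ) (hn : 1 ≤ n) : Cᵒᵖ ⥤ C ⥤ AddCommGrpCat.{max u v} where
  obj A :=
    { obj B := AddCommGrpCat.of (YExt (r.RQ A.unop) (r.RQ B) n)
      map g := AddCommGrpCat.ofHom (YExt.push (r.mapRQ g))
      map_id B := by
        ext x
        exact (push_eq (r.cof_RQ _) (r.mapRQ_id B) hn x).trans (YExt.push_id x)
      map_comp g g' := by
        ext x
        exact (push_eq (r.cof_RQ _) (r.mapRQ_comp g g') hn x).trans (YExt.push_comp _ _ x) }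
  map f :=
    { app B := AddCommGrpCat.ofHom (YExt.pull (r.mapRQ f.unop))
      naturality B B' g := by
        ext x
        exact YExt.pull_push (r.mapRQ f.unop) (r.mapRQ g) x }
  map_id A := by
    ext B x
    exact (pull_eq (r.fib_R _) (r.mapRQ_id A.unop) hn x).trans (YExt.pull_id x)
  map_comp f f' := by
    ext B x
    exact (pull_eq (r.fib_R _) (r.mapRQ_comp f'.unop f.unop) hn x).trans (YExt.pull_comp _ _ x)

/-- The functor `(A, B) ↦ Extⁿ(QA, RB)` for `n ≥ 1`. -/
noncomputable def qrExt (n : ℕ) (hn : 1 ≤ n) : Cᵒᵖ ⥤ C ⥤ AddCommGrpCat.{max u v} where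
  obj A :=
    { obj B := AddCommGrpCat.of (YExt (r.Q A.unop) (r.R B) n)
      map g := AddCommGrpCat.ofHom (YExt.push (r.mapR g))
      map_id B := by
        ext x
        exact (push_eq (r.cof_Q _) (r.mapR_id B) hn x).trans (YExt.push_id x)
      map_comp g g' := by
        ext x
        exact (push_eq (r.cof_Q _) (r.mapR_comp g g') hn x).trans (YExt.push_comp _ _ x) }
  map f :=
    { app B := AddCommGrpCat.ofHom (YExt.pull (r.mapQ f.unop))
      naturality B B' g := by
        ext x
        exact YExt.pull_push (r.mapQ f.unop) (r.mapR g) x }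
  map_id A := by
    ext B x
    exact (pull_eq (r.fib_R _) (r.mapQ_id A.unop) hn x).trans (YExt.pull_id x)
  map_comp f f' := by
    ext B x
    exact (pull_eq (r.fib_R _) (r.mapQ_comp f'.unop f.unop) hn x).trans (YExt.pull_comp _ _ x)

/-- Restriction of a bifunctor on `Ho(M)` along the canonical functor `γ` in both variables. -/
noncomputable def restrict (E : r.Hoᵒᵖ ⥤ r.Ho ⥤ AddCommGrpCat.{max u v}) :
    Cᵒᵖ ⥤ C ⥤ AddCommGrpCat.{max u v} :=
  r.γ.op ⋙ E ⋙ (Functor.whiskeringLeft _ _ _).obj r.γ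

/-- The iterates of an endofunctor. -/
def iter {D : Type*} [Category D] (F : D ⥤ D) : ℕ → D ⥤ D
  | 0 => 𝟭 D
  | n + 1 => iter F n ⋙ F

/-- The functor `(A, B) ↦ Ho(M)(ΩⁿA, B)`. -/
noncomputable def loopHom (ℓ : ∀ A, M.LoopSequence A) (n : ℕ) :
    r.Hoᵒᵖ ⥤ r.Ho ⥤ AddCommGrpCat.{max u v} :=
  (iter (loopFunctor r ℓ) n).op ⋙ preadditiveCoyoneda ⋙
    (Functor.whiskeringRight _ _ _).obj AddCommGrpCat.uliftFunctor.{u}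

/-- The functor `(A, B) ↦ Ho(M)(A, ΣⁿB)`. -/
noncomputable def suspHom (s : ∀ A, M.SuspensionSequence A) (n : ℕ) :
    r.Hoᵒᵖ ⥤ r.Ho ⥤ AddCommGrpCat.{max u v} :=
  (preadditiveCoyoneda ⋙ (Functor.whiskeringRight _ _ _).obj AddCommGrpCat.uliftFunctor.{u}) ⋙
    (Functor.whiskeringLeft _ _ _).obj (iter (suspFunctor r s) n)

end HereditaryModelStructure

open Opposite

/-- A sequence of functors indexed by the integers `n ≥ 1` sends short exact sequences
`0 ⟶ X₁ ⟶ X₂ ⟶ X₃ ⟶ 0` to long exact sequences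
`F¹X₁ ⟶ F¹X₂ ⟶ F¹X₃ ⟶ F²X₁ ⟶ F²X₂ ⟶ F²X₃ ⟶ F³X₁ ⟶ ⋯`. -/
def HasLongExactSequences (F : ∀ n : ℕ, 1 ≤ n → C ⥤ AddCommGrpCat.{max u v}) : Prop :=
  ∀ S : ShortComplex C, S.ShortExact →
    ∃ δ : ∀ (n : ℕ) (hn : 1 ≤ n), (F n hn).obj S.X₃ ⟶ (F (n + 1) (by omega)).obj S.X₁,
      ∀ (n : ℕ) (hn : 1 ≤ n),
        Function.Exact ((F n hn).map S.f) ((F n hn).map S.g) ∧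
        Function.Exact ((F n hn).map S.g) (δ n hn) ∧
        Function.Exact (δ n hn) ((F (n + 1) (by omega)).map S.f)

/-- A sequence of contravariant functors indexed by the integers `n ≥ 1` sends short exact sequences
`0 ⟶ X₁ ⟶ X₂ ⟶ X₃ ⟶ 0` to long exact sequences
`G¹X₃ ⟶ G¹X₂ ⟶ G¹X₁ ⟶ G²X₃ ⟶ G²X₂ ⟶ G²X₁ ⟶ G³X₃ ⟶ ⋯`. -/
def HasLongExactSequencesOp (G : ∀ n : ℕ, 1 ≤ n → Cᵒᵖ ⥤ AddCommGrpCat.{max u v}) : Prop :=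
  ∀ S : ShortComplex C, S.ShortExact →
    ∃ δ : ∀ (n : ℕ) (hn : 1 ≤ n), (G n hn).obj (op S.X₁) ⟶ (G (n + 1) (by omega)).obj (op S.X₃),
      ∀ (n : ℕ) (hn : 1 ≤ n),
        Function.Exact ((G n hn).map S.g.op) ((G n hn).map S.f.op) ∧
        Function.Exact ((G n hn).map S.f.op) (δ n hn) ∧
        Function.Exact (δ n hn) ((G (n + 1) (by omega)).map S.g.op)

end HoveyExt

open CategoryTheory Opposite HoveyExt HoveyExt.HereditaryModelStructure

namespace HoveyExt

universe v u w

variable {C : Type u} [Category.{v} C] [Abelian C]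

/-! ### Long exact sequences of Yoneda extensions -/

namespace YExt

open Abelian

attribute [local instance] hasExt

variable {A A' B B' X Y : C} {n : ℕ}

/-! Everything rests on the vanishing given by heredity. In degrees n ≥ 1, Extⁿ(X, -) vanishes on
trivially fibrant objects when X is cofibrant, and Extⁿ(-, Y) vanishes on trivially cofibrant
objects when Y is fibrant. Hence both functors identify homotopic morphisms (`push_eq`, `pull_eq`).
An epimorphism with trivially fibrant kernel induces isomorphisms on the first, and a monomorphism
with trivially cofibrant cokernel induces isomorphisms on the second.

Comparison of Extⁿ(RQA, RQB) with Extⁿ(QA, RB): pull back along QA → RQA, whose cokernel is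
trivially cofibrant, and push out along R(p_B) : RQB → RB. Up to homotopy the latter is an
epimorphism with trivially fibrant kernel followed by a comparison of two fibrant replacements of B
(`push_mapR_p_bijective`).

Long exact sequences: a horseshoe argument, whose obstruction lies in a vanishing Ext², replaces a
short exact sequence by a short exact sequence of fibrant (or cofibrant) replacements. The usual
long exact sequence of that sequence is moved to the chosen replacements by homotopy invariance, and
then to Extⁿ(RQA, RQB) by the comparison above.

Descent: by homotopy invariance Extⁿ(RQA, RQB) depends functorially on homotopy classes alone
(`stableExt`).

Loops and suspensions: the row 0 → RQΩA → W → RQA → 0 of a bifibrant approximation has its middle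
term in the core. In positive degrees its connecting map is therefore an isomorphism Extⁿ(RQΩA, RQB)
≅ Extⁿ⁺¹(RQA, RQB). In degree zero Hom(RQΩA, RQB) → Ext¹(RQA, RQB) is onto, and its kernel consists
of the morphisms that factor through the core, so Ho(ΩA, B) ≅ Ext¹. Induction on n gives Ho(ΩⁿA, B),
and the dual argument gives Ho(A, ΣⁿB). -/

theorem pull_add (α α' : A' ⟶ A) (x : YExt A B n) : pull (α + α') x = pull α x + pull α' x := by
  have := pull_sub α' (α + α') x
  rw [add_sub_cancel_right] at this
  rw [this, sub_add_cancel]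

theorem push_add (β β' : B ⟶ B') (x : YExt A B n) : push (β + β') x = push β x + push β' x := by
  have := push_sub β' (β + β') x
  rw [add_sub_cancel_right] at this
  rw [this, sub_add_cancel]

theorem push_zero (x : YExt A B n) : push (0 : B ⟶ B') x = 0 := by
  simpa using push_sub (0 : B ⟶ B') 0 x

/-- The element of `Ext⁰(A, B)` given by a morphism. -/
noncomputable def ofHom : (A ⟶ B) →+ YExt A B 0 :=
  equiv.symm.toAddMonoidHom.comp Ext.addEquiv₀.symm.toAddMonoidHom

theorem toExt_ofHom (f : A ⟶ B) : (ofHom f).toExt = Ext.mk₀ f :=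
  equiv.apply_symm_apply _

theorem ofHom_bijective : Function.Bijective (ofHom : (A ⟶ B) → YExt A B 0) :=
  equiv.symm.bijective.comp Ext.addEquiv₀.symm.bijective

theorem pull_ofHom (α : A' ⟶ A) (f : A ⟶ B) : pull α (ofHom f) = ofHom (α ≫ f) :=
  toExt_injective (by rw [toExt_pull, toExt_ofHom, toExt_ofHom, Ext.mk₀_comp_mk₀])

theorem push_ofHom (β : B ⟶ B') (f : A ⟶ B) : push β (ofHom f) = ofHom (f ≫ β) :=
  toExt_injective (by rw [toExt_push, toExt_ofHom, toExt_ofHom, Ext.mk₀_comp_mk₀])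

variable {S S' : ShortComplex C} (hS : S.ShortExact) (hS' : S'.ShortExact)

/-- The connecting homomorphism `Extⁿ(X, S₃) ⟶ Extⁿ⁺¹(X, S₁)`. -/
noncomputable def covδ : YExt X S.X₃ n →+ YExt X S.X₁ (n + 1) :=
  (equiv.symm.toAddMonoidHom.comp (hS.extClass.postcomp X rfl)).comp equiv.toAddMonoidHom

/-- The connecting homomorphism `Extⁿ(S₁, Y) ⟶ Extⁿ⁺¹(S₃, Y)`. -/
noncomputable def contraδ : YExt S.X₁ Y n →+ YExt S.X₃ Y (n + 1) :=
  (equiv.symm.toAddMonoidHom.comp (hS.extClass.precomp Y (add_comm 1 n))).comp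
    equiv.toAddMonoidHom

theorem toExt_covδ (x : YExt X S.X₃ n) : (covδ hS x).toExt = x.toExt.comp hS.extClass rfl :=
  equiv.apply_symm_apply _

theorem toExt_contraδ (x : YExt S.X₁ Y n) :
    (contraδ hS x).toExt = hS.extClass.comp x.toExt (add_comm 1 n) :=
  equiv.apply_symm_apply _

theorem pull_covδ (α : A' ⟶ A) (x : YExt A S.X₃ n) :
    pull α (covδ hS x) = covδ hS (pull α x) :=
  toExt_injective (by
    rw [toExt_pull, toExt_covδ, toExt_covδ, toExt_pull, Ext.comp_assoc _ _ _ _ _ (by omega)])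

theorem push_contraδ (β : B ⟶ B') (x : YExt S.X₁ B n) :
    push β (contraδ hS x) = contraδ hS (push β x) :=
  toExt_injective (by
    rw [toExt_push, toExt_contraδ, toExt_contraδ, toExt_push, Ext.comp_assoc_of_third_deg_zero])

/-- A morphism of short exact sequences says exactly that the class of `S` pushed out along `φ.τ₁`
is the class of `S'` pulled back along `φ.τ₃`; associativity of the Yoneda product does the rest.
This and `pull_contraδ` later yield compatibility with Σ and Ω. -/
theorem push_covδ (φ : S ⟶ S') (x : YExt X S.X₃ n) :
    push φ.τ₁ (covδ hS x) = covδ hS' (push φ.τ₃ x) :=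
  toExt_injective (by
    rw [toExt_push, toExt_covδ, toExt_covδ, toExt_push, Ext.comp_assoc_of_third_deg_zero,
      ShortComplex.ShortExact.extClass_naturality hS hS' φ, Ext.comp_assoc_of_second_deg_zero])

theorem pull_contraδ (φ : S ⟶ S') (x : YExt S'.X₁ Y n) :
    pull φ.τ₃ (contraδ hS' x) = contraδ hS (pull φ.τ₁ x) :=
  toExt_injective (by
    rw [toExt_pull, toExt_contraδ, toExt_contraδ, toExt_pull,
      ← Ext.comp_assoc_of_second_deg_zero, ShortComplex.ShortExact.extClass_naturality hS hS' φ,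
      Ext.comp_assoc _ _ _ (zero_add 1) _ (by omega)])

/-- The six exactness statements are those of `Abelian.Ext`, carried over by the bijection `toExt`,
under which pullback, pushout and the connecting maps become Yoneda products. -/
theorem exact_push_push (hS : S.ShortExact) :
    Function.Exact (push S.f : YExt X S.X₁ n →+ _) (push S.g : _ →+ YExt X S.X₃ n) := by
  intro x
  constructor
  · intro hx
    obtain ⟨y, hy⟩ := Ext.covariant_sequence_exact₂ X hS x.toExt (by
      rw [← toExt_push, hx, toExt_zero])
    obtain ⟨y, rfl⟩ := toExt_surjective y
    exact ⟨y, toExt_injective ((toExt_push _ _).trans hy)⟩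
  · rintro ⟨y, rfl⟩
    rw [← push_comp, S.zero, push_zero]

theorem exact_push_covδ :
    Function.Exact (push S.g : YExt X S.X₂ n →+ _) (covδ hS) := by
  intro x
  constructor
  · intro hx
    obtain ⟨y, hy⟩ := Ext.covariant_sequence_exact₃ X hS x.toExt rfl (by
      rw [← toExt_covδ, hx, toExt_zero])
    obtain ⟨y, rfl⟩ := toExt_surjective y
    exact ⟨y, toExt_injective ((toExt_push _ _).trans hy)⟩
  · rintro ⟨y, rfl⟩
    refine toExt_injective ?_
    rw [toExt_covδ, toExt_push, Ext.comp_assoc_of_second_deg_zero, hS.comp_extClass, Ext.comp_zero,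
      toExt_zero]

theorem exact_covδ_push :
    Function.Exact (covδ hS) (push S.f : YExt X S.X₁ (n + 1) →+ _) := by
  intro x
  constructor
  · intro hx
    obtain ⟨y, hy⟩ := Ext.covariant_sequence_exact₁ X hS x.toExt (by
      rw [← toExt_push, hx, toExt_zero]) rfl
    obtain ⟨y, rfl⟩ := toExt_surjective y
    exact ⟨y, toExt_injective ((toExt_covδ _ _).trans hy)⟩
  · rintro ⟨y, rfl⟩
    refine toExt_injective ?_
    rw [toExt_push, toExt_covδ, Ext.comp_assoc_of_third_deg_zero, hS.extClass_comp, Ext.comp_zero,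
      toExt_zero]

theorem exact_pull_pull (hS : S.ShortExact) :
    Function.Exact (pull S.g : YExt S.X₃ Y n →+ _) (pull S.f : _ →+ YExt S.X₁ Y n) := by
  intro x
  constructor
  · intro hx
    obtain ⟨y, hy⟩ := Ext.contravariant_sequence_exact₂ hS Y x.toExt (by
      rw [← toExt_pull, hx, toExt_zero])
    obtain ⟨y, rfl⟩ := toExt_surjective y
    exact ⟨y, toExt_injective ((toExt_pull _ _).trans hy)⟩
  · rintro ⟨y, rfl⟩
    refine toExt_injective ?_
    rw [toExt_pull, toExt_pull, Ext.mk₀_comp_mk₀_assoc, S.zero, Ext.mk₀_zero, Ext.zero_comp,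
      toExt_zero]

theorem exact_pull_contraδ :
    Function.Exact (pull S.f : YExt S.X₂ Y n →+ _) (contraδ hS) := by
  intro x
  constructor
  · intro hx
    obtain ⟨y, hy⟩ := Ext.contravariant_sequence_exact₁ hS Y x.toExt (add_comm 1 n) (by
      rw [← toExt_contraδ, hx, toExt_zero])
    obtain ⟨y, rfl⟩ := toExt_surjective y
    exact ⟨y, toExt_injective ((toExt_pull _ _).trans hy)⟩
  · rintro ⟨y, rfl⟩
    refine toExt_injective ?_
    rw [toExt_contraδ, toExt_pull, hS.extClass_comp_assoc, toExt_zero]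

theorem exact_contraδ_pull :
    Function.Exact (contraδ hS) (pull S.g : YExt S.X₃ Y (n + 1) →+ _) := by
  intro x
  constructor
  · intro hx
    obtain ⟨y, hy⟩ := Ext.contravariant_sequence_exact₃ hS Y x.toExt (by
      rw [← toExt_pull, hx, toExt_zero]) (add_comm 1 n)
    obtain ⟨y, rfl⟩ := toExt_surjective y
    exact ⟨y, toExt_injective ((toExt_contraδ _ _).trans hy)⟩
  · rintro ⟨y, rfl⟩
    refine toExt_injective ?_
    rw [toExt_pull, toExt_contraδ, hS.comp_extClass_assoc, toExt_zero]

end YExt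

/-! ### Isomorphisms forced by vanishing neighbours; dimension shifting. -/

theorem injective_of_exact {G₁ G₂ G₃ : Type*} [AddCommGroup G₁] [AddCommGroup G₂]
    [AddCommGroup G₃] {f : G₁ →+ G₂} {g : G₂ →+ G₃} (h : Function.Exact f g) (h₁ : Subsingleton G₁) :
    Function.Injective g := by
  rw [injective_iff_map_eq_zero]
  intro x hx
  obtain ⟨y, rfl⟩ := (h x).1 hx
  rw [Subsingleton.elim y 0, map_zero]

theorem surjective_of_exact {G₁ G₂ G₃ : Type*} [AddCommGroup G₁] [AddCommGroup G₂]
    [AddCommGroup G₃] {f : G₁ →+ G₂} {g : G₂ →+ G₃} (h : Function.Exact f g) (h₃ : Subsingleton G₃) :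
    Function.Surjective f :=
  fun x => (h x).1 (Subsingleton.elim _ _)

namespace YExt

variable {X Y : C} {n : ℕ} {S : ShortComplex C} (hS : S.ShortExact)

theorem push_bijective (hS : S.ShortExact) (h : Subsingleton (YExt X S.X₁ n))
    (h' : Subsingleton (YExt X S.X₁ (n + 1))) :
    Function.Bijective (push S.g : YExt X S.X₂ n →+ YExt X S.X₃ n) :=
  ⟨injective_of_exact (exact_push_push hS) h, surjective_of_exact (exact_push_covδ hS) h'⟩

theorem pull_bijective (hS : S.ShortExact) (h : Subsingleton (YExt S.X₃ Y n))
    (h' : Subsingleton (YExt S.X₃ Y (n + 1))) :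
    Function.Bijective (pull S.f : YExt S.X₂ Y n →+ YExt S.X₁ Y n) :=
  ⟨injective_of_exact (exact_pull_pull hS) h, surjective_of_exact (exact_pull_contraδ hS) h'⟩

/-- Dimension shifting: the two neighbours of the connecting map in the long exact sequence are the
groups of the middle object in degrees n and n + 1. -/
theorem covδ_bijective (h : Subsingleton (YExt X S.X₂ n))
    (h' : Subsingleton (YExt X S.X₂ (n + 1))) :
    Function.Bijective (covδ hS : YExt X S.X₃ n →+ YExt X S.X₁ (n + 1)) :=
  ⟨injective_of_exact (exact_push_covδ hS) h, surjective_of_exact (exact_covδ_push hS) h'⟩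

theorem contraδ_bijective (h : Subsingleton (YExt S.X₂ Y n))
    (h' : Subsingleton (YExt S.X₂ Y (n + 1))) :
    Function.Bijective (contraδ hS : YExt S.X₁ Y n →+ YExt S.X₃ Y (n + 1)) :=
  ⟨injective_of_exact (exact_pull_contraδ hS) h, surjective_of_exact (exact_contraδ_pull hS) h'⟩

end YExt

/-! ### Two cases of the 3 × 3 lemma -/

/-- The kernels of a morphism of short exact sequences which is epi on both ends form a short exact
sequence. -/
theorem exists_shortExact_kernels {S S' : ShortComplex C}
    (hS : S.ShortExact) (hS' : S'.ShortExact) (φ : S ⟶ S') {K₁ K₃ : C}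
    {i₁ : K₁ ⟶ S.X₁} {w₁ : i₁ ≫ φ.τ₁ = 0} (h₁ : (ShortComplex.mk i₁ φ.τ₁ w₁).ShortExact)
    {i₃ : K₃ ⟶ S.X₃} {w₃ : i₃ ≫ φ.τ₃ = 0} (h₃ : (ShortComplex.mk i₃ φ.τ₃ w₃).ShortExact) :
    ∃ (K₂ : C) (i₂ : K₂ ⟶ S.X₂) (w₂ : i₂ ≫ φ.τ₂ = 0) (a : K₁ ⟶ K₂) (b : K₂ ⟶ K₃) (w : a ≫ b = 0),
      (ShortComplex.mk i₂ φ.τ₂ w₂).ShortExact ∧ (ShortComplex.mk a b w).ShortExact := by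
  have := hS.mono_f
  have := hS.epi_g
  have := hS'.mono_f
  have := hS'.epi_g
  have e₁ : Epi φ.τ₁ := h₁.epi_g
  have e₃ : Epi φ.τ₃ := h₃.epi_g
  have m₁ : Mono i₁ := h₁.mono_f
  have m₃ : Mono i₃ := h₃.mono_f
  have e₂ : Epi φ.τ₂ := ShortComplex.epi_τ₂_of_exact_of_epi φ hS'.exact
  have c₁ := φ.comm₁₂
  have c₂ := φ.comm₂₃
  have hκ := shortExact_kernel φ.τ₂
  obtain ⟨a, ha⟩ := exists_lift hκ (i₁ ≫ S.f)
    (by dsimp; rw [Category.assoc, ← c₁, reassoc_of% w₁, zero_comp])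
  obtain ⟨b, hb⟩ := exists_lift h₃ (kernel.ι φ.τ₂ ≫ S.g)
    (by dsimp; rw [Category.assoc, ← c₂, kernel.condition_assoc, zero_comp])
  dsimp at ha hb
  have hab : a ≫ b = 0 := by
    rw [← cancel_mono i₃, Category.assoc, hb, reassoc_of% ha, S.zero, comp_zero, zero_comp]
  have ma : Mono a := by
    have : Mono (a ≫ kernel.ι φ.τ₂) := by rw [ha]; infer_instance
    exact mono_of_mono a (kernel.ι φ.τ₂)
  have eb : Epi b := by
    rw [epi_iff_surjective_up_to_refinements]
    intro T t
    -- Chase up to refinement: a lift `x` of the given element to `S.X₂` need not lie in the kernel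
    -- of `φ.τ₂`. Its image comes from `S'.X₁`, hence from some `z` into `S.X₁` because `φ.τ₁` is
    -- epi; subtracting the image of `z` corrects `x` without changing it in `S.X₃`.
    obtain ⟨T', π, hπ, x, hx⟩ := surjective_up_to_refinements_of_epi S.g (t ≫ i₃)
    obtain ⟨y, hy⟩ := exists_lift hS' (x ≫ φ.τ₂) (by
      rw [Category.assoc, c₂, ← reassoc_of% hx, w₃, comp_zero, comp_zero])
    obtain ⟨T'', π', hπ', z, hz⟩ := surjective_up_to_refinements_of_epi φ.τ₁ y
    obtain ⟨l, hl⟩ := exists_lift hκ (π' ≫ x - z ≫ S.f) (by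
      dsimp
      rw [Preadditive.sub_comp, Category.assoc, Category.assoc, ← hy, ← c₁, reassoc_of% hz, sub_self])
    dsimp at hl
    refine ⟨T'', π' ≫ π, inferInstance, l, ?_⟩
    rw [← cancel_mono i₃, Category.assoc, Category.assoc, Category.assoc, hb, reassoc_of% hl,
      Preadditive.sub_comp, Category.assoc, Category.assoc, S.zero, comp_zero, sub_zero, hx]
  refine ⟨_, _, _, a, b, hab, hκ, shortExact_of_lift ma eb (fun k hk => ?_)⟩
  dsimp at k hk ⊢
  have h0 : (k ≫ kernel.ι φ.τ₂) ≫ S.g = 0 := by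
    rw [Category.assoc, ← hb, reassoc_of% hk, zero_comp]
  obtain ⟨l, hl⟩ := exists_lift hS _ h0
  obtain ⟨m, hm⟩ := exists_lift h₁ l (by
    dsimp
    rw [← cancel_mono S'.f, Category.assoc, c₁, reassoc_of% hl, kernel.condition, comp_zero,
      zero_comp])
  dsimp at hm
  refine ⟨m, ?_⟩
  rw [← cancel_mono (kernel.ι φ.τ₂), Category.assoc, ha, reassoc_of% hm, hl]

/-- The cokernels of a morphism of short exact sequences which is mono on both ends form a short
exact sequence. -/
theorem exists_shortExact_cokernels {S S' : ShortComplex C}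
    (hS : S.ShortExact) (hS' : S'.ShortExact) (φ : S ⟶ S') {D₁ D₃ : C}
    {p₁ : S'.X₁ ⟶ D₁} {w₁ : φ.τ₁ ≫ p₁ = 0} (h₁ : (ShortComplex.mk φ.τ₁ p₁ w₁).ShortExact)
    {p₃ : S'.X₃ ⟶ D₃} {w₃ : φ.τ₃ ≫ p₃ = 0} (h₃ : (ShortComplex.mk φ.τ₃ p₃ w₃).ShortExact) :
    ∃ (D₂ : C) (p₂ : S'.X₂ ⟶ D₂) (w₂ : φ.τ₂ ≫ p₂ = 0) (a : D₁ ⟶ D₂) (b : D₂ ⟶ D₃) (w : a ≫ b = 0),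
      (ShortComplex.mk φ.τ₂ p₂ w₂).ShortExact ∧ (ShortComplex.mk a b w).ShortExact := by
  have := hS.mono_f
  have := hS.epi_g
  have := hS'.mono_f
  have := hS'.epi_g
  have m₁ : Mono φ.τ₁ := h₁.mono_f
  have m₃ : Mono φ.τ₃ := h₃.mono_f
  have e₁ : Epi p₁ := h₁.epi_g
  have e₃ : Epi p₃ := h₃.epi_g
  have m₂ : Mono φ.τ₂ := ShortComplex.mono_τ₂_of_exact_of_mono φ hS.exact
  have c₁ := φ.comm₁₂
  have c₂ := φ.comm₂₃
  have hκ := shortExact_cokernel φ.τ₂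
  obtain ⟨a, ha⟩ := exists_desc h₁ (S'.f ≫ cokernel.π φ.τ₂)
    (by dsimp; rw [reassoc_of% c₁, cokernel.condition, comp_zero])
  obtain ⟨b, hb⟩ := exists_desc hκ (S'.g ≫ p₃)
    (by dsimp; rw [reassoc_of% c₂, w₃, comp_zero])
  dsimp at ha hb
  have hab : a ≫ b = 0 := by
    rw [← cancel_epi p₁, reassoc_of% ha, hb, S'.zero_assoc, zero_comp, comp_zero]
  have eb : Epi b := by
    have : Epi (cokernel.π φ.τ₂ ≫ b) := by rw [hb]; infer_instance
    exact epi_of_epi (cokernel.π φ.τ₂) b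
  have ma : Mono a := by
    refine Preadditive.mono_of_cancel_zero a (fun {T} t ht => ?_)
    -- If the class of `y` dies in the middle cokernel, then `y ≫ S'.f` comes from some `x` into
    -- `S.X₂`. Injectivity of `φ.τ₃` moves `x` into `S.X₁`, so `y` already factors through `φ.τ₁`.
    obtain ⟨T', π, hπ, y, hy⟩ := surjective_up_to_refinements_of_epi p₁ t
    have h0 : (y ≫ S'.f) ≫ cokernel.π φ.τ₂ = 0 := by
      rw [Category.assoc, ← ha, ← reassoc_of% hy, ht, comp_zero]
    obtain ⟨x, hx⟩ := exists_lift hκ (y ≫ S'.f) h0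
    dsimp at hx
    obtain ⟨z, hz⟩ := exists_lift hS x (by
      rw [← cancel_mono φ.τ₃, Category.assoc, ← c₂, reassoc_of% hx, S'.zero, comp_zero, zero_comp])
    have hzy : z ≫ φ.τ₁ = y := by
      rw [← cancel_mono S'.f, Category.assoc, c₁, reassoc_of% hz, hx]
    rw [← cancel_epi π, hy, ← hzy, Category.assoc, w₁, comp_zero, comp_zero]
  refine ⟨_, _, _, a, b, hab, hκ, shortExact_of_desc ma eb (fun k hk => ?_)⟩
  dsimp at k hk ⊢
  have h0 : S'.f ≫ cokernel.π φ.τ₂ ≫ k = 0 := by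
    rw [← reassoc_of% ha, hk, comp_zero]
  obtain ⟨l, hl⟩ := exists_desc hS' _ h0
  obtain ⟨m, hm⟩ := exists_desc h₃ l (by
    dsimp
    rw [← cancel_epi S.g, ← reassoc_of% c₂, hl, cokernel.condition_assoc, zero_comp, comp_zero])
  dsimp at hm
  refine ⟨m, ?_⟩
  rw [← cancel_epi (cokernel.π φ.τ₂), reassoc_of% hb, hm, hl]

/-! ### Uniqueness of replacements up to homotopy -/

namespace AbelianModelStructure

variable {M : AbelianModelStructure C} {S : ShortComplex C}

/-- The difference of the two morphisms vanishes on `S.X₁`, so it factors through the trivially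
cofibrant `S.X₃`; since the target is fibrant, `factors_of_fib` reroutes it through the core. It
extends `homotopic_of_j` from the chosen replacements to arbitrary ones. -/
theorem homotopic_of_comp_eq_left (hS : S.ShortExact) (h₃ : (M.cof ⊓ M.triv) S.X₃) {Y : C}
    (hY : M.fib Y) {g g' : S.X₂ ⟶ Y} (h : S.f ≫ g = S.f ≫ g') : M.homotopic g g' := by
  obtain ⟨l, hl⟩ := exists_desc hS (g' - g) (by rw [Preadditive.comp_sub, h, sub_self])
  obtain ⟨V, a, b, hV, hab⟩ := factors_of_fib hY h₃ S.g l
  exact ⟨V, a, b, hV, hab.trans hl⟩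

theorem homotopic_of_comp_eq_right (hS : S.ShortExact) (h₁ : (M.triv ⊓ M.fib) S.X₁) {X : C}
    (hX : M.cof X) {g g' : X ⟶ S.X₂} (h : g ≫ S.g = g' ≫ S.g) : M.homotopic g g' := by
  obtain ⟨l, hl⟩ := exists_lift hS (g' - g) (by rw [Preadditive.sub_comp, h, sub_self])
  obtain ⟨V, a, b, hV, hab⟩ := factors_of_cof hX h₁ l S.f
  exact ⟨V, a, b, hV, hab.trans hl⟩

end AbelianModelStructure

namespace HereditaryModelStructure

open AbelianModelStructure

variable {M : HereditaryModelStructure C} {X Y : C} {n : ℕ}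

/-- The two morphisms are inverse up to homotopy, and Extⁿ(X, -) does not see homotopies in positive
degrees. Neither `E` nor `E'` has to be fibrant or cofibrant. -/
theorem push_bijective_of_inverse (hX : M.cof X) (hn : 1 ≤ n) {E E' : C} {a : E ⟶ E'} {b : E' ⟶ E}
    (hab : M.homotopic (a ≫ b) (𝟙 E)) (hba : M.homotopic (b ≫ a) (𝟙 E')) :
    Function.Bijective (YExt.push a : YExt X E n →+ YExt X E' n) :=
  Function.bijective_iff_has_inverse.2 ⟨YExt.push b,
    fun x => by rw [← YExt.push_comp, push_eq hX hab hn, YExt.push_id],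
    fun x => by rw [← YExt.push_comp, push_eq hX hba hn, YExt.push_id]⟩

theorem pull_bijective_of_inverse (hY : M.fib Y) (hn : 1 ≤ n) {E E' : C} {a : E ⟶ E'} {b : E' ⟶ E}
    (hab : M.homotopic (a ≫ b) (𝟙 E)) (hba : M.homotopic (b ≫ a) (𝟙 E')) :
    Function.Bijective (YExt.pull a : YExt E' Y n →+ YExt E Y n) :=
  Function.bijective_iff_has_inverse.2 ⟨YExt.pull b,
    fun x => by rw [← YExt.pull_comp, pull_eq hY hba hn, YExt.pull_id],
    fun x => by rw [← YExt.pull_comp, pull_eq hY hab hn, YExt.pull_id]⟩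

/-- A morphism between special preenvelopes of an object induces isomorphisms on `Extⁿ(X, -)` for
`X` cofibrant. -/
theorem push_bijective_of_preenvelopes (hX : M.cof X) (hn : 1 ≤ n) {A : C}
    (P P' : M.FibrantReplacement A) (a : P.obj ⟶ P'.obj) (ha : P.ι ≫ a = P'.ι) :
    Function.Bijective (YExt.push a : YExt X P.obj n →+ YExt X P'.obj n) := by
  -- A morphism back under `A` exists because the cokernel of `P'.ι` is trivially cofibrant and
  -- `P.obj` is fibrant. Both composites agree with identities on `A`, hence are homotopic to them.
  obtain ⟨b, hb⟩ := extend_of_ext P'.shortExact (ext_right P'.mem_coker P.mem) P.ι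
  dsimp at b hb
  refine push_bijective_of_inverse hX hn (b := b)
    (homotopic_of_comp_eq_left P.shortExact P.mem_coker P.mem ?_)
    (homotopic_of_comp_eq_left P'.shortExact P'.mem_coker P'.mem ?_)
  · dsimp
    rw [reassoc_of% ha, hb, Category.comp_id]
  · dsimp
    rw [reassoc_of% hb, ha, Category.comp_id]

/-- A morphism between special precovers of an object induces isomorphisms on `Extⁿ(-, Y)` for `Y`
fibrant. -/
theorem pull_bijective_of_precovers (hY : M.fib Y) (hn : 1 ≤ n) {A : C}
    (P P' : M.CofibrantReplacement A) (a : P.obj ⟶ P'.obj) (ha : a ≫ P'.π = P.π) :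
    Function.Bijective (YExt.pull a : YExt P'.obj Y n →+ YExt P.obj Y n) := by
  -- Dually, a morphism back over `A` exists because `P'.obj` is cofibrant and the kernel of `P.π`
  -- is trivially fibrant.
  obtain ⟨b, hb⟩ := lift_of_ext P.shortExact (ext_left P'.mem P.mem_ker) P'.π
  dsimp at b hb
  refine pull_bijective_of_inverse hY hn (b := b)
    (homotopic_of_comp_eq_right P.shortExact P.mem_ker P.mem ?_)
    (homotopic_of_comp_eq_right P'.shortExact P'.mem_ker P'.mem ?_)
  · dsimp
    rw [Category.assoc, hb, ha, Category.id_comp]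
  · dsimp
    rw [Category.assoc, ha, hb, Category.id_comp]

/-- Fibrant objects are closed under quotients by trivially fibrant subobjects. -/
theorem fib_quotient {S : ShortComplex C} (hS : S.ShortExact) (h₁ : M.fib S.X₁) (h₂ : M.fib S.X₂) :
    M.fib S.X₃ :=
  (M.right_cotorsion.right _).2 fun A hA => by
    -- Heredity enters here: Ext¹(A, S.X₃) lies between Ext¹(A, S.X₂) and Ext²(A, S.X₁). Fibrancy of
    -- `S.X₁` suffices for this.
    have e₁ : Subsingleton (YExt A S.X₁ 2) := M.right_hereditary A _ hA h₁ 2 (by omega)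
    have e₂ : Subsingleton (YExt A S.X₂ 1) := ext_right hA h₂
    exact (surjective_of_exact (YExt.exact_push_covδ hS) e₁).subsingleton

end HereditaryModelStructure

/-- A natural isomorphism between bifunctors with values in abelian groups, given by natural
bijective homomorphisms. -/
noncomputable def bifunctorIso {D D' : Type*} [Category* D] [Category* D']
    {F G : D ⥤ D' ⥤ AddCommGrpCat.{w}}
    (e : ∀ A B, (F.obj A).obj B →+ (G.obj A).obj B) (he : ∀ A B, Function.Bijective (e A B))
    (h₁ : ∀ {A A' : D} (f : A ⟶ A') (B : D') (x : (F.obj A).obj B),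
      e A' B ((F.map f).app B x) = (G.map f).app B (e A B x))
    (h₂ : ∀ (A : D) {B B' : D'} (g : B ⟶ B') (x : (F.obj A).obj B),
      e A B' ((F.obj A).map g x) = (G.obj A).map g (e A B x)) : F ≅ G :=
  NatIso.ofComponents
    (fun A => NatIso.ofComponents
      (fun B => (AddEquiv.ofBijective (e A B) (he A B)).toAddCommGrpIso)
      (fun g => AddCommGrpCat.ext (h₂ A g)))
    (fun f => NatTrans.ext (funext fun B => AddCommGrpCat.ext (h₁ f B)))

/-! ### Comparison of Extⁿ(RQA, RQB) with Extⁿ(QA, RB). -/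

namespace HereditaryModelStructure

variable {M : HereditaryModelStructure C} (r : M.Replacements)

open AbelianModelStructure Replacements Opposite

variable {n : ℕ}

/-- The morphism `R(p_B) : RQB ⟶ RB` induces isomorphisms on `Extⁿ(X, -)` for `X` cofibrant. -/
theorem push_mapR_p_bijective (hn : 1 ≤ n) {X : C} (hX : M.cof X) (B : C) :
    Function.Bijective (YExt.push (r.mapR (r.p B)) : YExt X (r.RQ B) n →+ YExt X (r.R B) n) := by
  have hi := (r.fibRep (r.Q B)).shortExact
  have hp := (r.cofRep B).shortExact
  have m₁ : Mono (r.j (r.Q B)) := hi.mono_f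
  have m₂ : Mono (r.cofRep B).ι := hp.mono_f
  have m₃ : Epi (r.p B) := hp.epi_g
  -- The pushout of QB → RQB along QB → B is an intermediate object between RQB and RB: `a : RQB ⟶
  -- P` is epi with the same kernel as `p_B`, while B → P has the same cokernel as QB → RQB.
  let P : C := pushout (r.j (r.Q B)) (r.p B)
  let a : r.RQ B ⟶ P := pushout.inl _ _
  have w : ((r.cofRep B).ι ≫ r.j (r.Q B)) ≫ a = 0 := by
    rw [Category.assoc, pushout.condition, reassoc_of% (r.cofRep B).w, zero_comp]
  have hT : (ShortComplex.mk ((r.cofRep B).ι ≫ r.j (r.Q B)) a w).ShortExact :=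
    shortExact_of_desc (mono_comp _ _) (inferInstanceAs (Epi (pushout.inl _ _))) (fun k hk => by
      obtain ⟨l, hl⟩ := exists_desc hp (r.j (r.Q B) ≫ k) (by simpa using hk)
      exact ⟨pushout.desc k l hl.symm, pushout.inl_desc _ _ _⟩)
  -- `P` is a quotient of the fibrant RQB by a fibrant subobject, so B → P is itself a fibrant
  -- replacement and can be compared with RB.
  have hP : M.fib P := fib_quotient hT (r.cofRep B).mem_ker.2 (r.fib_R _)
  let P' : M.FibrantReplacement B :=
    ⟨_, _, _, shortExact_pushout _ _ _ hi (r.p B), hP, (r.fibRep (r.Q B)).mem_coker⟩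
  obtain ⟨b, hb⟩ := extend_of_ext P'.shortExact (ext_right P'.mem_coker (r.fib_R B)) (r.j B)
  have h₁ := YExt.push_bijective hT
    (M.left_hereditary X _ hX (r.cofRep B).mem_ker n hn)
    (M.left_hereditary X _ hX (r.cofRep B).mem_ker (n + 1) (by omega))
  have h₂ := push_bijective_of_preenvelopes hX hn P' (r.fibRep B) b hb
  -- `R(p_B)` is an arbitrary choice, so it need not equal the composite; the two agree on QB, which
  -- determines a morphism from RQB to a fibrant object up to homotopy.
  have h₃ : M.homotopic (r.mapR (r.p B)) (a ≫ b) := r.homotopic_of_j (r.fib_R B) (by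
    rw [j_mapR, ← hb]
    exact (pushout.condition_assoc b).symm)
  convert! h₂.comp h₁ using 1
  ext x
  exact (push_eq hX h₃ hn x).trans (YExt.push_comp _ _ x)

/-- The cokernel of `A ⟶ RA` is trivially cofibrant, so its Ext groups into the fibrant `Y` vanish
in the adjacent degrees n and n + 1. -/
theorem pull_j_bijective (hn : 1 ≤ n) {Y : C} (hY : M.fib Y) (A : C) :
    Function.Bijective (YExt.pull (r.j A) : YExt (r.R A) Y n →+ YExt A Y n) :=
  YExt.pull_bijective (r.fibRep A).shortExact
    (M.right_hereditary _ Y (r.fibRep A).mem_coker hY n hn)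
    (M.right_hereditary _ Y (r.fibRep A).mem_coker hY (n + 1) (by omega))

/-- The natural isomorphism `Extⁿ(RQA, RQB) ≅ Extⁿ(QA, RB)`. -/
noncomputable def hoExtIso (hn : 1 ≤ n) : hoExt r n hn ≅ qrExt r n hn :=
  bifunctorIso
    (fun A B => (YExt.push (r.mapR (r.p B))).comp (YExt.pull (r.j (r.Q A.unop))))
    (fun A B => (push_mapR_p_bijective r hn (r.cof_Q _) B).comp
      (pull_j_bijective r hn (r.fib_R _) _))
    (fun {A A'} f B (x : YExt (r.RQ A.unop) (r.RQ B) n) => by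
      change YExt.push _ (YExt.pull _ (YExt.pull (r.mapRQ f.unop) x)) =
        YExt.pull (r.mapQ f.unop) (YExt.push _ (YExt.pull _ x))
      rw [YExt.pull_push, ← YExt.pull_comp, ← YExt.pull_comp, j_mapR])
    (fun A {B B'} g (x : YExt (r.RQ A.unop) (r.RQ B) n) => by
      change YExt.push _ (YExt.pull _ (YExt.push (r.mapRQ g) x)) =
        YExt.push (r.mapR g) (YExt.push _ (YExt.pull _ x))
      rw [YExt.pull_push, ← YExt.push_comp, ← YExt.push_comp]
      -- Naturality in A holds by an equation of morphisms, but in B the square formed by R(Q(g)),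
      -- R(g) and the morphisms R(p) commutes only up to homotopy. It suffices to compare both sides
      -- on QB.
      refine push_eq (r.cof_Q _) (r.homotopic_of_j (r.fib_R _) ?_) hn _
      rw [← Category.assoc, j_mapR, Category.assoc, j_mapR, reassoc_of% (r.mapQ_p g),
        ← Category.assoc (r.j _), j_mapR, Category.assoc, j_mapR])

/-! ### Long exact sequences -/

section approximations

open Abelian

attribute [local instance] hasExt

variable {S : ShortComplex C}

/-- Horseshoe: the class of `S`, pushed out to R(S.X₁), extends along S.X₃ → R(S.X₃), since the
obstruction lies in Ext² from a trivially cofibrant object to a fibrant one. The middle term is not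
the chosen R(S.X₂), only some fibrant replacement of S.X₂. -/
theorem exists_fibrantApproximation (hS : S.ShortExact) :
    ∃ (P : M.FibrantReplacement S.X₂) (f : r.R S.X₁ ⟶ P.obj) (g : P.obj ⟶ r.R S.X₃) (w : f ≫ g = 0),
      (ShortComplex.mk f g w).ShortExact ∧ S.f ≫ P.ι = r.j _ ≫ f ∧ P.ι ≫ g = S.g ≫ r.j _ := by
  have v : Subsingleton (YExt (r.fibRep S.X₃).coker (r.R S.X₁) 2) :=
    M.right_hereditary _ _ (r.fibRep _).mem_coker (r.fib_R _) 2 (by omega)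
  obtain ⟨y, hy⟩ := Ext.contravariant_sequence_exact₁ (r.fibRep S.X₃).shortExact (r.R S.X₁)
    (hS.extClass.comp (Ext.mk₀ (r.j S.X₁)) (add_zero 1)) (n₁ := 2) rfl (YExt.ext_eq_zero _)
  obtain ⟨E, f, g, w, h, rfl⟩ := exists_shortExact y
  obtain ⟨t, ht₁, ht₂⟩ := exists_mid hS h (r.j _) (r.j _) hy.symm
  -- The cokernel of the middle vertical morphism is an extension of the two outer cokernels, hence
  -- again trivially cofibrant.
  obtain ⟨D, p, w', a, b, w'', h₁, h₂⟩ := exists_shortExact_cokernels hS h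
    { τ₁ := r.j _, τ₂ := t, τ₃ := r.j _, comm₁₂ := ht₁.symm, comm₂₃ := ht₂ }
    (r.fibRep S.X₁).shortExact (r.fibRep S.X₃).shortExact
  exact ⟨⟨t, p, w', h₁, fib_mid h (r.fib_R _) (r.fib_R _),
    cof_mid h₂ (r.fibRep _).mem_coker.1 (r.fibRep _).mem_coker.1,
    M.thick.mid _ h₂ (r.fibRep _).mem_coker.2 (r.fibRep _).mem_coker.2⟩, f, g, w, h, ht₁, ht₂⟩

/-- Dual horseshoe: the class of `S`, pulled back to Q(S.X₃), lifts along Q(S.X₁) → S.X₁, the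
obstruction lying in Ext² from a cofibrant object to a trivially fibrant one. -/
theorem exists_cofibrantApproximation (hS : S.ShortExact) :
    ∃ (P : M.CofibrantReplacement S.X₂) (f : r.Q S.X₁ ⟶ P.obj) (g : P.obj ⟶ r.Q S.X₃)
      (w : f ≫ g = 0), (ShortComplex.mk f g w).ShortExact ∧ f ≫ P.π = r.p _ ≫ S.f ∧
        P.π ≫ S.g = g ≫ r.p _ := by
  have v : Subsingleton (YExt (r.Q S.X₃) (r.cofRep S.X₁).ker 2) :=
    M.left_hereditary _ _ (r.cof_Q _) (r.cofRep S.X₁).mem_ker 2 (by omega)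
  obtain ⟨x, hx⟩ := Ext.covariant_sequence_exact₃ (r.Q S.X₃) (r.cofRep S.X₁).shortExact
    ((Ext.mk₀ (r.p S.X₃)).comp hS.extClass (zero_add 1)) (n₁ := 2) rfl (YExt.ext_eq_zero _)
  obtain ⟨E, f, g, w, h, rfl⟩ := exists_shortExact x
  obtain ⟨t, ht₁, ht₂⟩ := exists_mid h hS (r.p _) (r.p _) hx
  obtain ⟨K, i, w', a, b, w'', h₁, h₂⟩ := exists_shortExact_kernels h hS
    { τ₁ := r.p _, τ₂ := t, τ₃ := r.p _, comm₁₂ := ht₁.symm, comm₂₃ := ht₂ }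
    (r.cofRep S.X₁).shortExact (r.cofRep S.X₃).shortExact
  exact ⟨⟨i, t, w', h₁,
    ⟨M.thick.mid _ h₂ (r.cofRep _).mem_ker.1 (r.cofRep _).mem_ker.1,
      fib_mid h₂ (r.cofRep _).mem_ker.2 (r.cofRep _).mem_ker.2⟩,
    cof_mid h (r.cof_Q _) (r.cof_Q _)⟩, f, g, w, h, ht₁, ht₂⟩

end approximations

end HereditaryModelStructure

section exact

variable {G₁ G₂ G₂' G₃ : Type*} [AddCommGroup G₁] [AddCommGroup G₂] [AddCommGroup G₂']
  [AddCommGroup G₃]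

/-- This and the next two lemmas replace the middle term of a long exact sequence by an isomorphic
group, one for each of the three exactness positions. The outer groups and the connecting map stay
the same. -/
theorem exact_of_bijective_mid {f : G₁ →+ G₂} {g : G₂ →+ G₃} {f' : G₁ →+ G₂'} {g' : G₂' →+ G₃}
    {e : G₂ →+ G₂'} (he : Function.Bijective e) (hf : ∀ x, e (f x) = f' x)
    (hg : ∀ x, g' (e x) = g x) (h : Function.Exact f' g') : Function.Exact f g := fun x => by
  rw [← hg, h]
  simp only [Set.mem_range, ← hf, he.1.eq_iff]

theorem exact_of_surjective_left {g : G₁ →+ G₂} {g' : G₂' →+ G₂} {d : G₂ →+ G₃}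
    {e : G₁ →+ G₂'} (he : Function.Surjective e)
    (hg : ∀ x, g' (e x) = g x) (h : Function.Exact g' d) : Function.Exact g d := fun x => by
  rw [h]
  simp only [Set.mem_range, ← hg, he.exists]

theorem exact_of_injective_right {d : G₁ →+ G₂} {f : G₂ →+ G₃} {f' : G₂ →+ G₂'}
    {e : G₃ →+ G₂'} (he : Function.Injective e)
    (hf : ∀ x, e (f x) = f' x) (h : Function.Exact d f') : Function.Exact d f := fun x => by
  rw [← h, ← hf, map_eq_zero_iff e he]

end exact

namespace HereditaryModelStructure

open AbelianModelStructure Replacements Opposite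

variable {M : HereditaryModelStructure C} (r : M.Replacements)

/-- Extⁿ(QA, -) is applied to the exact sequence R(X₁) → P → R(X₃) of the horseshoe, whose outer
terms are the chosen replacements. Only P must be exchanged for R(X₂). -/
theorem hasLongExactSequences_qrExt (A : C) :
    HasLongExactSequences (fun n hn => (qrExt r n hn).obj (op A)) := by
  intro S hS
  obtain ⟨P, f, g, w, h, hf, hg⟩ := exists_fibrantApproximation r hS
  -- The comparison `u : R(X₂) ⟶ P` under X₂ is an isomorphism on Extⁿ(QA, -). Through it R(S.f) and
  -- R(S.g) match the horseshoe maps up to homotopy, because the triangles commute after restriction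
  -- along `j`.
  obtain ⟨u, hu⟩ := extend_of_ext (r.fibRep S.X₂).shortExact
    (ext_right (r.fibRep S.X₂).mem_coker P.mem) P.ι
  dsimp at u hu
  have hb (n : ℕ) (hn : 1 ≤ n) := push_bijective_of_preenvelopes (r.cof_Q A) hn (r.fibRep S.X₂) P u hu
  have hf' (n : ℕ) (hn : 1 ≤ n) (x : YExt (r.Q A) (r.R S.X₁) n) :
      YExt.push u (YExt.push (r.mapR S.f) x) = YExt.push f x := by
    rw [← YExt.push_comp]
    refine push_eq (r.cof_Q A) (r.homotopic_of_j P.mem ?_) hn x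
    rw [← Category.assoc, j_mapR, Category.assoc, hu, hf]
  have hg' (n : ℕ) (hn : 1 ≤ n) (x : YExt (r.Q A) (r.R S.X₂) n) :
      YExt.push g (YExt.push u x) = YExt.push (r.mapR S.g) x := by
    rw [← YExt.push_comp]
    refine push_eq (r.cof_Q A) (r.homotopic_of_j (r.fib_R _) ?_) hn x
    rw [j_mapR, reassoc_of% hu, hg]
  exact ⟨fun n hn => AddCommGrpCat.ofHom (YExt.covδ h), fun n hn =>
    ⟨exact_of_bijective_mid (hb n hn) (hf' n hn) (hg' n hn) (YExt.exact_push_push h),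
      exact_of_surjective_left (hb n hn).2 (hg' n hn) (YExt.exact_push_covδ h),
      exact_of_injective_right (hb (n + 1) (by omega)).1 (hf' (n + 1) (by omega))
        (YExt.exact_covδ_push h)⟩⟩

theorem hasLongExactSequencesOp_qrExt (B : C) :
    HasLongExactSequencesOp (fun n hn => (qrExt r n hn).flip.obj B) := by
  intro S hS
  obtain ⟨P, f, g, w, h, hf, hg⟩ := exists_cofibrantApproximation r hS
  -- Here the comparison goes from the horseshoe term to Q(X₂), over X₂; pulling back along it is an
  -- isomorphism on Extⁿ(-, RB).
  obtain ⟨u, hu⟩ := lift_of_ext (r.cofRep S.X₂).shortExact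
    (ext_left P.mem (r.cofRep S.X₂).mem_ker) P.π
  dsimp at u hu
  have hb (n : ℕ) (hn : 1 ≤ n) := pull_bijective_of_precovers (r.fib_R B) hn P (r.cofRep S.X₂) u hu
  have hg' (n : ℕ) (hn : 1 ≤ n) (x : YExt (r.Q S.X₃) (r.R B) n) :
      YExt.pull u (YExt.pull (r.mapQ S.g) x) = YExt.pull g x := by
    rw [← YExt.pull_comp]
    refine pull_eq (r.fib_R B) (r.homotopic_of_p P.mem ?_) hn x
    rw [Category.assoc, mapQ_p, reassoc_of% hu, hg]
  have hf' (n : ℕ) (hn : 1 ≤ n) (x : YExt (r.Q S.X₂) (r.R B) n) :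
      YExt.pull f (YExt.pull u x) = YExt.pull (r.mapQ S.f) x := by
    rw [← YExt.pull_comp]
    refine pull_eq (r.fib_R B) (r.homotopic_of_p (r.cof_Q _) ?_) hn x
    rw [mapQ_p, Category.assoc, hu, hf]
  exact ⟨fun n hn => AddCommGrpCat.ofHom (YExt.contraδ h), fun n hn =>
    ⟨exact_of_bijective_mid (hb n hn) (hg' n hn) (hf' n hn) (YExt.exact_pull_pull h),
      exact_of_surjective_left (hb n hn).2 (hf' n hn) (YExt.exact_pull_contraδ h),
      exact_of_injective_right (hb (n + 1) (by omega)).1 (hg' (n + 1) (by omega))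
        (YExt.exact_contraδ_pull h)⟩⟩

end HereditaryModelStructure

/-- The two maps between abelian groups form an exact sequence if and only if an isomorphic pair of
maps does. -/
theorem exact_of_iso {G₁ G₂ G₃ G₁' G₂' G₃' : AddCommGrpCat.{w}} {f : G₁ ⟶ G₂} {g : G₂ ⟶ G₃}
    {f' : G₁' ⟶ G₂'} {g' : G₂' ⟶ G₃'} (e₁ : G₁ ≅ G₁') (e₂ : G₂ ≅ G₂') (e₃ : G₃ ≅ G₃')
    (hf : f ≫ e₂.hom = e₁.hom ≫ f') (hg : g ≫ e₃.hom = e₂.hom ≫ g')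
    (h : Function.Exact f' g') : Function.Exact f g := by
  have w' : f' ≫ g' = 0 := AddCommGrpCat.ext h.apply_apply_eq_zero
  have w : f ≫ g = 0 := by
    rw [← cancel_mono e₃.hom, Category.assoc, hg, reassoc_of% hf, w', comp_zero, zero_comp]
  have H := ShortComplex.exact_of_iso (S₁ := ShortComplex.mk f' g' w') (S₂ := ShortComplex.mk f g w)
    (ShortComplex.isoMk e₁ e₂ e₃ hf.symm hg.symm).symm
    ((ShortComplex.ab_exact_iff_function_exact _).2 h)
  exact (ShortComplex.ab_exact_iff_function_exact _).1 H

open Opposite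

theorem HasLongExactSequences.of_iso {F G : ∀ n : ℕ, 1 ≤ n → C ⥤ AddCommGrpCat.{max u v}}
    (e : ∀ n hn, F n hn ≅ G n hn) (hG : HasLongExactSequences G) : HasLongExactSequences F := by
  intro S hS
  obtain ⟨δ, hδ⟩ := hG S hS
  refine ⟨fun n hn => (e n hn).hom.app _ ≫ δ n hn ≫ (e (n + 1) (by omega)).inv.app _,
    fun n hn => ⟨?_, ?_, ?_⟩⟩
  · exact exact_of_iso ((e n hn).app _) ((e n hn).app _) ((e n hn).app _) (by simp) (by simp)
      (hδ n hn).1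
  · exact exact_of_iso ((e n hn).app _) ((e n hn).app _) ((e (n + 1) (by omega)).app _)
      (by simp) (by simp) (hδ n hn).2.1
  · exact exact_of_iso ((e n hn).app _) ((e (n + 1) (by omega)).app _) ((e (n + 1) (by omega)).app _)
      (by simp) (by simp) (hδ n hn).2.2

theorem HasLongExactSequencesOp.of_iso {F G : ∀ n : ℕ, 1 ≤ n → Cᵒᵖ ⥤ AddCommGrpCat.{max u v}}
    (e : ∀ n hn, F n hn ≅ G n hn) (hG : HasLongExactSequencesOp G) : HasLongExactSequencesOp F := by
  intro S hS
  obtain ⟨δ, hδ⟩ := hG S hS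
  refine ⟨fun n hn => (e n hn).hom.app _ ≫ δ n hn ≫ (e (n + 1) (by omega)).inv.app _,
    fun n hn => ⟨?_, ?_, ?_⟩⟩
  · exact exact_of_iso ((e n hn).app _) ((e n hn).app _) ((e n hn).app _) (by simp) (by simp)
      (hδ n hn).1
  · exact exact_of_iso ((e n hn).app _) ((e n hn).app _) ((e (n + 1) (by omega)).app _)
      (by simp) (by simp) (hδ n hn).2.1
  · exact exact_of_iso ((e n hn).app _) ((e (n + 1) (by omega)).app _) ((e (n + 1) (by omega)).app _)
      (by simp) (by simp) (hδ n hn).2.2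

namespace HereditaryModelStructure

open AbelianModelStructure Replacements

variable {M : HereditaryModelStructure C} (r : M.Replacements)

/-- Transport from Extⁿ(QA, RB), where a single replacement in each variable suffices for the
horseshoe. -/
theorem hasLongExactSequences_hoExt (A : C) :
    HasLongExactSequences (fun n hn => (hoExt r n hn).obj (op A)) :=
  (hasLongExactSequences_qrExt r A).of_iso (fun _ hn => (hoExtIso r hn).app (op A))

theorem hasLongExactSequencesOp_hoExt (B : C) :
    HasLongExactSequencesOp (fun n hn => (hoExt r n hn).flip.obj B) :=
  (hasLongExactSequencesOp_qrExt r B).of_iso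
    (fun _ hn => ((flipFunctor _ _ _).mapIso (hoExtIso r hn)).app B)

/-! ### Additivity in each variable. -/

theorem mapQ_add {A B : C} (f g : A ⟶ B) :
    M.homotopic (r.mapQ (f + g)) (r.mapQ f + r.mapQ g) :=
  r.homotopic_of_p (r.cof_Q A) (by
    rw [mapQ_p, Preadditive.add_comp, mapQ_p, mapQ_p, Preadditive.comp_add])

theorem mapRQ_add {A B : C} (f g : A ⟶ B) :
    M.homotopic (r.mapRQ (f + g)) (r.mapRQ f + r.mapRQ g) :=
  r.homotopic_mapR (mapQ_add r f g) (r.j_mapR _) (by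
    rw [Preadditive.comp_add, j_mapR, j_mapR, Preadditive.add_comp])

variable {n : ℕ} (hn : 1 ≤ n)

/-- The assignment f ↦ R(Q(f)) is additive only up to homotopy, both sides covering the same
morphism; in positive degrees that is enough. -/
theorem additive_hoExt_obj (A : C) : ((hoExt r n hn).obj (op A)).Additive where
  map_add {_ _ f g} := AddCommGrpCat.ext fun x =>
    (push_eq (r.cof_RQ A) (mapRQ_add r f g) hn x).trans (YExt.push_add _ _ x)

theorem additive_hoExt_flip_obj (B : C) : ((hoExt r n hn).flip.obj B).Additive where
  map_add {_ _ f g} := AddCommGrpCat.ext fun x =>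
    (pull_eq (r.fib_R _) (mapRQ_add r f.unop g.unop) hn x).trans (YExt.pull_add _ _ x)

end HereditaryModelStructure

/-- Bifunctors which agree on objects and on morphisms in each variable are equal. -/
theorem bifunctor_ext {D D' E : Type*} [Category* D] [Category* D'] [Category* E]
    {F G : D ⥤ D' ⥤ E} (h : ∀ A B, (F.obj A).obj B = (G.obj A).obj B)
    (h₂ : ∀ (A : D) {B B' : D'} (g : B ⟶ B'), (F.obj A).map g ≍ (G.obj A).map g)
    (h₁ : ∀ {A A' : D} (f : A ⟶ A') (B : D'), (F.map f).app B ≍ (G.map f).app B) : F = G := by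
  -- The transformations have different types until the functors are identified, so heterogeneous
  -- equality is checked componentwise after substituting the equalities of functors.
  have key : ∀ {F₁ G₁ F₂ G₂ : D' ⥤ E} (_ : F₁ = F₂) (_ : G₁ = G₂) (α : F₁ ⟶ G₁) (β : F₂ ⟶ G₂)
      (_ : ∀ B, α.app B ≍ β.app B), α ≍ β := by
    rintro F₁ G₁ _ _ rfl rfl α β h
    exact heq_of_eq (NatTrans.ext (funext fun B => eq_of_heq (h B)))
  have hobj (A : D) : F.obj A = G.obj A := Functor.hext (h A) (fun _ _ g => h₂ A g)
  exact Functor.hext hobj (fun A A' f => key (hobj A) (hobj A') _ _ (h₁ f))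

/-- A homomorphism of abelian groups, as a homomorphism on the universe lift of its source. -/
def ofULift {G H : Type*} [AddCommGroup G] [AddCommGroup H] (f : G →+ H) : ULift.{w} G →+ H :=
  f.comp AddEquiv.ulift.toAddMonoidHom

theorem ofULift_bijective {G H : Type*} [AddCommGroup G] [AddCommGroup H] {f : G →+ H}
    (hf : Function.Bijective f) : Function.Bijective (ofULift.{w} f) :=
  hf.comp ULift.down_bijective

/-! ### Descent of Extⁿ(RQA, RQB) to the homotopy category. -/

namespace HereditaryModelStructure

open AbelianModelStructure Replacements Opposite

variable {M : HereditaryModelStructure C} (r : M.Replacements)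

/-- A morphism `RQA ⟶ RQB` which represents a morphism in the homotopy category. -/
noncomputable def rep {A B : r.Ho} (φ : A ⟶ B) : r.RQ A ⟶ r.RQ B :=
  (r.hoMk_surjective φ).choose

theorem hoMk_rep {A B : r.Ho} (φ : A ⟶ B) : r.hoMk (rep r φ) = φ :=
  (r.hoMk_surjective φ).choose_spec

/-- The chosen representative may be exchanged for any other inside a homotopy invariant
construction. Functoriality of `stableExt` and all later naturality checks rely on this. -/
theorem homotopic_rep {A B : r.Ho} {φ : A ⟶ B} {f : r.RQ A ⟶ r.RQ B} (h : r.hoMk f = φ) :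
    M.homotopic (rep r φ) f :=
  r.hoMk_eq_iff.1 ((hoMk_rep r φ).trans h.symm)

theorem homotopic_rep_id (A : r.Ho) : M.homotopic (rep r (𝟙 A)) (𝟙 _) :=
  homotopic_rep r (r.hoMk_id A)

theorem homotopic_rep_comp {A B D : r.Ho} (φ : A ⟶ B) (ψ : B ⟶ D) :
    M.homotopic (rep r (φ ≫ ψ)) (rep r φ ≫ rep r ψ) :=
  homotopic_rep r ((r.hoMk_comp _ _).trans (by rw [hoMk_rep, hoMk_rep]))

theorem hoMk_add {A B : C} (f g : r.RQ A ⟶ r.RQ B) : r.hoMk (f + g) = r.hoMk f + r.hoMk g :=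
  rfl

theorem homotopic_rep_add {A B : r.Ho} (φ ψ : A ⟶ B) :
    M.homotopic (rep r (φ + ψ)) (rep r φ + rep r ψ) :=
  homotopic_rep r ((hoMk_add r _ _).trans (by rw [hoMk_rep, hoMk_rep]))

variable {n : ℕ}

/-- The functor `(A, B) ↦ Extⁿ(RQA, RQB)` on the homotopy category. -/
noncomputable def stableExt (n : ℕ) (hn : 1 ≤ n) : r.Hoᵒᵖ ⥤ r.Ho ⥤ AddCommGrpCat.{max u v} where
  obj A :=
    { obj B := AddCommGrpCat.of (YExt (r.RQ A.unop) (r.RQ B) n)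
      map g := AddCommGrpCat.ofHom (YExt.push (rep r g))
      map_id B := by
        ext x
        exact (push_eq (r.cof_RQ _) (homotopic_rep_id r B) hn x).trans (YExt.push_id x)
      map_comp g g' := by
        ext x
        exact (push_eq (r.cof_RQ _) (homotopic_rep_comp r g g') hn x).trans (YExt.push_comp _ _ x) }
  map f :=
    { app B := AddCommGrpCat.ofHom (YExt.pull (rep r f.unop))
      naturality B B' g := by
        ext x
        exact YExt.pull_push (rep r f.unop) (rep r g) x }
  map_id A := by
    ext B x
    exact (pull_eq (r.fib_R _) (homotopic_rep_id r A.unop) hn x).trans (YExt.pull_id x)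
  map_comp f f' := by
    ext B x
    exact (pull_eq (r.fib_R _) (homotopic_rep_comp r f'.unop f.unop) hn x).trans
      (YExt.pull_comp _ _ x)

/-- Equality on the nose is available: the groups coincide definitionally, and the chosen
representative of γ(f) is homotopic to R(Q(f)), so the two induce equal maps on Ext. -/
theorem restrict_stableExt (hn : 1 ≤ n) : restrict r (stableExt r n hn) = hoExt r n hn :=
  bifunctor_ext (fun _ _ => rfl)
    (fun _ {_ _} _ => heq_of_eq (AddCommGrpCat.ext fun x =>
      push_eq (r.cof_RQ _) (homotopic_rep r rfl) hn x))
    (fun _ _ => heq_of_eq (AddCommGrpCat.ext fun x =>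
      pull_eq (r.fib_R _) (homotopic_rep r rfl) hn x))

/-- The functor `(A, B) ↦ Ho(M)(A, B)`. -/
noncomputable abbrev homFunctor : r.Hoᵒᵖ ⥤ r.Ho ⥤ AddCommGrpCat.{max u v} :=
  preadditiveCoyoneda ⋙ (Functor.whiskeringRight _ _ _).obj AddCommGrpCat.uliftFunctor.{u}

/-- An endofunctor commutes with its iterates. -/
def iterComm {D : Type*} [Category* D] (F : D ⥤ D) : ∀ n, iter F n ⋙ F ≅ F ⋙ iter F n
  | 0 => F.leftUnitor ≪≫ F.rightUnitor.symm
  | n + 1 => Functor.isoWhiskerRight (iterComm F n) F ≪≫ Functor.associator _ _ _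

/-! ### Connecting homomorphisms on morphisms modulo homotopy. -/

theorem homotopic_zero_of_factors {X W Y : C} (hW : M.core W) (a : X ⟶ W) (b : W ⟶ Y) :
    M.homotopic 0 (a ≫ b) := ⟨W, a, b, hW, by simp⟩

theorem subsingleton_ext_core_left {W Y : C} (hW : M.core W) (hY : M.fib Y) (hn : 1 ≤ n) :
    Subsingleton (YExt W Y n) :=
  M.right_hereditary W Y hW.1 hY n hn

theorem subsingleton_ext_core_right {X W : C} (hX : M.cof X) (hW : M.core W) (hn : 1 ≤ n) :
    Subsingleton (YExt X W n) :=
  M.left_hereditary X W hX ⟨hW.1.2, hW.2⟩ n hn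

/-- A morphism killed by the connecting map extends over `T.X₂`, which is in the core. Conversely,
for a morphism through a core object V the connecting map passes through Ext¹(T.X₃, V) = 0. -/
theorem contraδ_ofHom_eq_zero_iff {T : ShortComplex C} (hT : T.ShortExact)
    (hW : M.core T.X₂) (h₃ : M.cof T.X₃) {Y : C} (f : T.X₁ ⟶ Y) :
    YExt.contraδ hT (YExt.ofHom f) = 0 ↔ M.homotopic 0 f := by
  constructor
  · intro h
    obtain ⟨y, hy⟩ := (YExt.exact_pull_contraδ hT _).1 h
    obtain ⟨b, rfl⟩ := YExt.ofHom_bijective.2 y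
    rw [YExt.pull_ofHom] at hy
    rw [← YExt.ofHom_bijective.1 hy]
    exact homotopic_zero_of_factors hW _ _
  · rintro ⟨V, a, b, hV, h⟩
    have := subsingleton_ext_core_right h₃ hV le_rfl
    rw [← sub_zero f, ← h, ← YExt.push_ofHom, ← YExt.push_contraδ,
      Subsingleton.elim (YExt.contraδ hT (YExt.ofHom a)) 0, map_zero]

/-- Dually, a morphism killed by the connecting map lifts to the core object `T.X₂`, and one that
factors through a core object V is killed because Ext¹(V, T.X₁) = 0. -/
theorem covδ_ofHom_eq_zero_iff {T : ShortComplex C} (hT : T.ShortExact)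
    (hW : M.core T.X₂) (h₁ : M.fib T.X₁) {X : C} (f : X ⟶ T.X₃) :
    YExt.covδ hT (YExt.ofHom f) = 0 ↔ M.homotopic 0 f := by
  constructor
  · intro h
    obtain ⟨y, hy⟩ := (YExt.exact_push_covδ hT _).1 h
    obtain ⟨b, rfl⟩ := YExt.ofHom_bijective.2 y
    rw [YExt.push_ofHom] at hy
    rw [← YExt.ofHom_bijective.1 hy]
    exact homotopic_zero_of_factors hW _ _
  · rintro ⟨V, a, b, hV, h⟩
    have := subsingleton_ext_core_left hV h₁ le_rfl
    rw [← sub_zero f, ← h, ← YExt.pull_ofHom, ← YExt.pull_covδ,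
      Subsingleton.elim (YExt.covδ hT (YExt.ofHom b)) 0, map_zero]

theorem homotopic_zero_rep_iff {A B : r.Ho} (φ : A ⟶ B) : M.homotopic 0 (rep r φ) ↔ φ = 0 := by
  rw [← r.hoMk_eq_iff, hoMk_rep]
  exact eq_comm

theorem contraδ_ofHom_eq {T : ShortComplex C} (hT : T.ShortExact) (hW : M.core T.X₂)
    (h₃ : M.cof T.X₃) {Y : C} {f g : T.X₁ ⟶ Y} (h : M.homotopic f g) :
    YExt.contraδ hT (YExt.ofHom f) = YExt.contraδ hT (YExt.ofHom g) := by
  have := (contraδ_ofHom_eq_zero_iff hT hW h₃ (g - f)).2 (homotopic_iff_sub.1 h)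
  rw [map_sub, map_sub] at this
  exact (sub_eq_zero.1 this).symm

theorem covδ_ofHom_eq {T : ShortComplex C} (hT : T.ShortExact) (hW : M.core T.X₂)
    (h₁ : M.fib T.X₁) {X : C} {f g : X ⟶ T.X₃} (h : M.homotopic f g) :
    YExt.covδ hT (YExt.ofHom f) = YExt.covδ hT (YExt.ofHom g) := by
  have := (covδ_ofHom_eq_zero_iff hT hW h₁ (g - f)).2 (homotopic_iff_sub.1 h)
  rw [map_sub, map_sub] at this
  exact (sub_eq_zero.1 this).symm

theorem pull_contraδ_ofHom {T T' : ShortComplex C} (hT : T.ShortExact) (hT' : T'.ShortExact)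
    {k : T.X₁ ⟶ T'.X₁} {f : T.X₃ ⟶ T'.X₃} (h : Connects T T' k f) {Y : C} (a : T'.X₁ ⟶ Y) :
    YExt.pull f (YExt.contraδ hT' (YExt.ofHom a)) = YExt.contraδ hT (YExt.ofHom (k ≫ a)) := by
  obtain ⟨φ, rfl, rfl⟩ := h
  rw [YExt.pull_contraδ hT, YExt.pull_ofHom]

theorem push_covδ_ofHom {T T' : ShortComplex C} (hT : T.ShortExact) (hT' : T'.ShortExact)
    {k : T.X₁ ⟶ T'.X₁} {f : T.X₃ ⟶ T'.X₃} (h : Connects T T' k f) {X : C} (a : X ⟶ T.X₃) :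
    YExt.push k (YExt.covδ hT (YExt.ofHom a)) = YExt.covδ hT' (YExt.ofHom (a ≫ f)) := by
  obtain ⟨φ, rfl, rfl⟩ := h
  rw [YExt.push_covδ hT hT', YExt.push_ofHom]

/-! ### Ho(ΩⁿA, B) ≅ Extⁿ(A, B). -/

section loop

variable (ℓ : ∀ A, M.LoopSequence A)

theorem shortExact_loopTop (A : C) : (loopTop r ℓ A).ShortExact := (loopApprox r ℓ A).rq_shortExact

/-- The homomorphism `Ho(M)(ΩA, B) ⟶ Ext¹(RQA, RQB)`. -/
noncomputable def loopConn (A B : r.Ho) :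
    ((loopFunctor r ℓ).obj A ⟶ B) →+ YExt (r.RQ A) (r.RQ B) 1 :=
  AddMonoidHom.mk' (fun φ => YExt.contraδ (shortExact_loopTop r ℓ A) (YExt.ofHom (rep r φ)))
    (fun φ ψ => by
      refine (contraδ_ofHom_eq (shortExact_loopTop r ℓ A) (core_loopTop r ℓ A) (r.cof_RQ _)
        (homotopic_rep_add r φ ψ)).trans ?_
      exact map_add ((YExt.contraδ (shortExact_loopTop r ℓ A)).comp YExt.ofHom) _ _)

theorem loopConn_hoMk (A B : C) (f : r.RQ (ℓ A).loop ⟶ r.RQ B) :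
    loopConn r ℓ A B (r.hoMk f) = YExt.contraδ (shortExact_loopTop r ℓ A) (YExt.ofHom f) :=
  contraδ_ofHom_eq (shortExact_loopTop r ℓ A) (core_loopTop r ℓ A) (r.cof_RQ _)
    (homotopic_rep r rfl)

/-- Injectivity holds because the kernel of the connecting map is the null-homotopic morphisms,
surjectivity because Ext¹ from the core object in the middle to RQB vanishes. -/
theorem loopConn_bijective (A B : r.Ho) : Function.Bijective (loopConn r ℓ A B) := by
  constructor
  · rw [injective_iff_map_eq_zero]
    intro φ h
    exact (homotopic_zero_rep_iff r φ).1 ((contraδ_ofHom_eq_zero_iff (shortExact_loopTop r ℓ A)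
      (core_loopTop r ℓ A) (r.cof_RQ _) _).1 h)
  · intro x
    obtain ⟨y, rfl⟩ := surjective_of_exact (YExt.exact_contraδ_pull (shortExact_loopTop r ℓ A))
      (subsingleton_ext_core_left (core_loopTop r ℓ A) (r.fib_R _) le_rfl) x
    obtain ⟨f, rfl⟩ := YExt.ofHom_bijective.2 y
    exact ⟨r.hoMk f, loopConn_hoMk r ℓ A B f⟩

/-- Ω is defined on morphisms by the left end of a morphism of top rows, and the connecting map is
natural for such morphisms. Homotopy invariance absorbs the choice of representatives. -/
theorem pull_contraδ_loopTop {A A' : r.Ho} (φ : A ⟶ A') {Y : C} (hY : M.fib Y) (hn : 1 ≤ n)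
    (x : YExt (r.RQ (ℓ A').loop) Y n) :
    YExt.contraδ (shortExact_loopTop r ℓ A) (YExt.pull (rep r ((loopFunctor r ℓ).map φ)) x) =
      YExt.pull (rep r φ) (YExt.contraδ (shortExact_loopTop r ℓ A') x) := by
  obtain ⟨f, rfl⟩ := r.hoMk_surjective φ
  obtain ⟨k, hk⟩ := exists_loop r ℓ f
  have h₁ : M.homotopic (rep r ((loopFunctor r ℓ).map (r.hoMk f))) k :=
    homotopic_rep r (loopMap_eq r ℓ f k hk).symm
  have h₂ : M.homotopic (rep r (r.hoMk f)) f := homotopic_rep r rfl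
  obtain ⟨φ, rfl, rfl⟩ := hk
  exact (congrArg _ (pull_eq hY h₁ hn x)).trans
    ((YExt.pull_contraδ _ _ φ x).symm.trans (pull_eq hY h₂ (by omega) _).symm)

/-- `Extⁿ(ΩA, B) ≅ Extⁿ⁺¹(A, B)` -/
noncomputable def loopStep (hn : 1 ≤ n) :
    (loopFunctor r ℓ).op ⋙ stableExt r n hn ≅ stableExt r (n + 1) (by omega) :=
  bifunctorIso
    (fun A B => YExt.contraδ (shortExact_loopTop r ℓ A.unop))
    (fun A B => YExt.contraδ_bijective (shortExact_loopTop r ℓ A.unop)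
      (subsingleton_ext_core_left (core_loopTop r ℓ A.unop) (r.fib_R _) hn)
      (subsingleton_ext_core_left (core_loopTop r ℓ A.unop) (r.fib_R _) (by omega)))
    (fun f B x => pull_contraδ_loopTop r ℓ f.unop (r.fib_R _) hn x)
    (fun A _ _ g x => (YExt.push_contraδ (shortExact_loopTop r ℓ A.unop) (rep r g) x).symm)

/-- `Ho(M)(ΩA, B) ≅ Ext¹(A, B)` -/
noncomputable def loopBase :
    (loopFunctor r ℓ).op ⋙ homFunctor r ≅ stableExt r 1 le_rfl :=
  bifunctorIso
    -- Degree zero is separate from `loopStep`: Hom out of the core object need not vanish, so Ext⁰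
    -- has to be replaced by morphisms modulo homotopy. The lift only adjusts universes.
    (fun A B => ofULift (loopConn r ℓ A.unop B))
    (fun A B => ofULift_bijective (loopConn_bijective r ℓ A.unop B))
    (fun {A A'} f B ⟨φ⟩ => by
      obtain ⟨k, rfl⟩ := r.hoMk_surjective φ
      obtain ⟨a, ha⟩ := r.hoMk_surjective f.unop
      obtain ⟨l, hl⟩ := exists_loop r ℓ a
      change loopConn r ℓ A'.unop B ((loopFunctor r ℓ).map f.unop ≫ r.hoMk k) =
        YExt.pull (rep r f.unop) (loopConn r ℓ A.unop B (r.hoMk k))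
      have h₁ : (loopFunctor r ℓ).map f.unop = r.hoMk l := by
        rw [← ha]
        exact loopMap_eq r ℓ a l hl
      rw [h₁]
      refine (congrArg _ (r.hoMk_comp l k).symm).trans ((loopConn_hoMk r ℓ _ _ _).trans ?_)
      refine Eq.trans ?_ (pull_eq (r.fib_R _) (homotopic_rep r ha) le_rfl _).symm
      refine Eq.trans ?_ (congrArg _ (loopConn_hoMk r ℓ _ _ k).symm)
      exact (pull_contraδ_ofHom _ _ hl k).symm)
    (fun A B B' g ⟨φ⟩ => by
      obtain ⟨k, rfl⟩ := r.hoMk_surjective φ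
      obtain ⟨b, rfl⟩ := r.hoMk_surjective g
      change loopConn r ℓ A.unop B' (r.hoMk k ≫ r.hoMk b) =
        YExt.push (rep r (r.hoMk b)) (loopConn r ℓ A.unop B (r.hoMk k))
      refine (congrArg _ (r.hoMk_comp k b).symm).trans ((loopConn_hoMk r ℓ _ _ _).trans ?_)
      refine Eq.trans ?_ (push_eq (r.cof_RQ _) (homotopic_rep r rfl) le_rfl _).symm
      refine Eq.trans ?_ (congrArg _ (loopConn_hoMk r ℓ _ _ k).symm)
      exact (congrArg _ (YExt.push_ofHom _ _).symm).trans (YExt.push_contraδ _ _ _).symm)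

/-- `Ho(M)(ΩⁿA, B) ≅ Extⁿ(A, B)` -/
noncomputable def loopHomIso : ∀ n : ℕ, loopHom r ℓ (n + 1) ≅ stableExt r (n + 1) (by omega)
  | 0 => loopBase r ℓ
  | n + 1 =>
    -- `iter` applies the extra Ω last, whereas the induction needs it first: Ho(Ωⁿ⁺¹(ΩA), B) ≅
    -- Extⁿ⁺¹(ΩA, B) ≅ Extⁿ⁺²(A, B).
    Functor.isoWhiskerRight (NatIso.op (iterComm (loopFunctor r ℓ) (n + 1))).symm (homFunctor r) ≪≫
      Functor.isoWhiskerLeft (loopFunctor r ℓ).op (loopHomIso n) ≪≫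
      loopStep r ℓ (by omega)

end loop

/-! ### Ho(A, ΣⁿB) ≅ Extⁿ(A, B), by the dual argument. -/

section suspension

variable (s : ∀ A, M.SuspensionSequence A)

theorem shortExact_suspTop (A : C) : (suspTop r s A).ShortExact := (suspApprox r s A).rq_shortExact

/-- The homomorphism `Ho(M)(A, ΣB) ⟶ Ext¹(RQA, RQB)`. -/
noncomputable def suspConn (A B : r.Ho) :
    (A ⟶ (suspFunctor r s).obj B) →+ YExt (r.RQ A) (r.RQ B) 1 :=
  AddMonoidHom.mk' (fun φ => YExt.covδ (shortExact_suspTop r s B) (YExt.ofHom (rep r φ)))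
    (fun φ ψ => by
      refine (covδ_ofHom_eq (shortExact_suspTop r s B) (core_suspTop r s B) (r.fib_R _)
        (homotopic_rep_add r φ ψ)).trans ?_
      exact map_add ((YExt.covδ (shortExact_suspTop r s B)).comp YExt.ofHom) _ _)

theorem suspConn_hoMk (A B : C) (f : r.RQ A ⟶ r.RQ (s B).susp) :
    suspConn r s A B (r.hoMk f) = YExt.covδ (shortExact_suspTop r s B) (YExt.ofHom f) :=
  covδ_ofHom_eq (shortExact_suspTop r s B) (core_suspTop r s B) (r.fib_R _)
    (homotopic_rep r rfl)

theorem suspConn_bijective (A B : r.Ho) : Function.Bijective (suspConn r s A B) := by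
  constructor
  · rw [injective_iff_map_eq_zero]
    intro φ h
    exact (homotopic_zero_rep_iff r φ).1 ((covδ_ofHom_eq_zero_iff (shortExact_suspTop r s B)
      (core_suspTop r s B) (r.fib_R _) _).1 h)
  · intro x
    obtain ⟨y, rfl⟩ := surjective_of_exact (YExt.exact_covδ_push (shortExact_suspTop r s B))
      (subsingleton_ext_core_right (r.cof_RQ _) (core_suspTop r s B) le_rfl) x
    obtain ⟨f, rfl⟩ := YExt.ofHom_bijective.2 y
    exact ⟨r.hoMk f, suspConn_hoMk r s A B f⟩

/-- As for loops: Σ is given by the right end of a morphism of top rows, along which the covariant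
connecting map is natural. -/
theorem push_covδ_suspTop {B B' : r.Ho} (φ : B ⟶ B') {X : C} (hX : M.cof X) (hn : 1 ≤ n)
    (x : YExt X (r.RQ (s B).susp) n) :
    YExt.covδ (shortExact_suspTop r s B') (YExt.push (rep r ((suspFunctor r s).map φ)) x) =
      YExt.push (rep r φ) (YExt.covδ (shortExact_suspTop r s B) x) := by
  obtain ⟨k, rfl⟩ := r.hoMk_surjective φ
  obtain ⟨f, hf⟩ := exists_susp r s k
  have h₁ : M.homotopic (rep r ((suspFunctor r s).map (r.hoMk k))) f :=
    homotopic_rep r (suspMap_eq r s k f hf).symm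
  have h₂ : M.homotopic (rep r (r.hoMk k)) k := homotopic_rep r rfl
  obtain ⟨φ, rfl, rfl⟩ := hf
  exact (congrArg _ (push_eq hX h₁ hn x)).trans
    ((YExt.push_covδ _ _ φ x).symm.trans (push_eq hX h₂ (by omega) _).symm)

/-- `Extⁿ(A, ΣB) ≅ Extⁿ⁺¹(A, B)` -/
noncomputable def suspStep (hn : 1 ≤ n) :
    stableExt r n hn ⋙ (Functor.whiskeringLeft _ _ _).obj (suspFunctor r s) ≅
      stableExt r (n + 1) (by omega) :=
  bifunctorIso
    (fun A B => YExt.covδ (shortExact_suspTop r s B))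
    (fun A B => YExt.covδ_bijective (shortExact_suspTop r s B)
      (subsingleton_ext_core_right (r.cof_RQ _) (core_suspTop r s B) hn)
      (subsingleton_ext_core_right (r.cof_RQ _) (core_suspTop r s B) (by omega)))
    (fun f B x => (YExt.pull_covδ (shortExact_suspTop r s B) (rep r f.unop) x).symm)
    (fun A _ _ g x => push_covδ_suspTop r s g (r.cof_RQ _) hn x)

/-- `Ho(M)(A, ΣB) ≅ Ext¹(A, B)` -/
noncomputable def suspBase :
    homFunctor r ⋙ (Functor.whiskeringLeft _ _ _).obj (suspFunctor r s) ≅ stableExt r 1 le_rfl :=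
  bifunctorIso
    (fun A B => ofULift (suspConn r s A.unop B))
    (fun A B => ofULift_bijective (suspConn_bijective r s A.unop B))
    (fun {A A'} f B ⟨φ⟩ => by
      obtain ⟨k, rfl⟩ := r.hoMk_surjective φ
      obtain ⟨a, ha⟩ := r.hoMk_surjective f.unop
      change suspConn r s A'.unop B (f.unop ≫ r.hoMk k) =
        YExt.pull (rep r f.unop) (suspConn r s A.unop B (r.hoMk k))
      rw [pull_eq (r.fib_R _) (homotopic_rep r ha) le_rfl, ← ha]
      refine (congrArg _ (r.hoMk_comp a k).symm).trans ((suspConn_hoMk r s _ _ _).trans ?_)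
      refine Eq.trans ?_ (congrArg _ (suspConn_hoMk r s _ _ k).symm)
      exact (congrArg _ (YExt.pull_ofHom _ _).symm).trans (YExt.pull_covδ _ _ _).symm)
    (fun A B B' g ⟨φ⟩ => by
      obtain ⟨k, rfl⟩ := r.hoMk_surjective φ
      obtain ⟨b, rfl⟩ := r.hoMk_surjective g
      obtain ⟨l, hl⟩ := exists_susp r s b
      change suspConn r s A.unop B' (r.hoMk k ≫ suspMap r s (r.hoMk b)) =
        YExt.push (rep r (r.hoMk b)) (suspConn r s A.unop B (r.hoMk k))
      rw [suspMap_eq r s b l hl]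
      refine (congrArg _ (r.hoMk_comp k l).symm).trans ((suspConn_hoMk r s _ _ _).trans ?_)
      refine Eq.trans ?_ (push_eq (r.cof_RQ _) (homotopic_rep r rfl) le_rfl _).symm
      refine Eq.trans ?_ (congrArg _ (suspConn_hoMk r s _ _ k).symm)
      exact (push_covδ_ofHom _ _ hl k).symm)

/-- `Ho(M)(A, ΣⁿB) ≅ Extⁿ(A, B)` -/
noncomputable def suspHomIso : ∀ n : ℕ, suspHom r s (n + 1) ≅ stableExt r (n + 1) (by omega)
  | 0 => suspBase r s
  | n + 1 =>
    -- The extra Σ is moved next to B, so that the induction hypothesis applies to the pair (A, ΣB).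
    Functor.isoWhiskerLeft (homFunctor r)
        ((Functor.whiskeringLeft _ _ _).mapIso (iterComm (suspFunctor r s) (n + 1))) ≪≫
      Functor.isoWhiskerRight (suspHomIso n)
        ((Functor.whiskeringLeft _ _ _).obj (suspFunctor r s)) ≪≫
      suspStep r s (by omega)

end suspension

/-- Restriction along the canonical functor respects isomorphisms. -/
noncomputable def restrictIso {E E' : r.Hoᵒᵖ ⥤ r.Ho ⥤ AddCommGrpCat.{max u v}} (e : E ≅ E') :
    restrict r E ≅ restrict r E' :=
  Functor.isoWhiskerLeft r.γ.op
    (Functor.isoWhiskerRight e ((Functor.whiskeringLeft _ _ _).obj r.γ))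

end HereditaryModelStructure

end HoveyExt

theorem mainTheorem3 {C : Type*} [Category C] [Abelian C] (M : HereditaryModelStructure C)
    (r : M.Replacements) (ℓ : ∀ A, M.LoopSequence A) (s : ∀ A, M.SuspensionSequence A) :
    (∀ A : C, (∀ (n : ℕ) (hn : 1 ≤ n), ((hoExt r n hn).obj (op A)).Additive) ∧
      HasLongExactSequences (fun n hn => (hoExt r n hn).obj (op A))) ∧
    (∀ B : C, (∀ (n : ℕ) (hn : 1 ≤ n), ((hoExt r n hn).flip.obj B).Additive) ∧
      HasLongExactSequencesOp (fun n hn => (hoExt r n hn).flip.obj B)) ∧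
    ∀ (n : ℕ) (hn : 1 ≤ n),
      (∃ E : r.Hoᵒᵖ ⥤ r.Ho ⥤ AddCommGrpCat, restrict r E = hoExt r n hn ∧
        Nonempty (loopHom r ℓ n ≅ E) ∧ Nonempty (E ≅ suspHom r s n)) ∧
      Nonempty (hoExt r n hn ≅ qrExt r n hn) ∧
      Nonempty (restrict r (loopHom r ℓ n) ≅ qrExt r n hn) ∧
      Nonempty (qrExt r n hn ≅ restrict r (suspHom r s n)) := by
  refine ⟨fun A => ⟨fun n hn => additive_hoExt_obj r hn A, hasLongExactSequences_hoExt r A⟩,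
    fun B => ⟨fun n hn => additive_hoExt_flip_obj r hn B, hasLongExactSequencesOp_hoExt r B⟩,
    fun n hn => ?_⟩
  -- The loop and suspension isomorphisms are indexed from degree n + 1.
  obtain ⟨n, rfl⟩ := Nat.exists_eq_add_of_le' hn
  have h : restrict r (stableExt r (n + 1) hn) ≅ qrExt r (n + 1) hn :=
    eqToIso (restrict_stableExt r hn) ≪≫ hoExtIso r hn
  -- The one bifunctor `stableExt` serves as the descended functor for both isomorphisms;
  -- restricting these along γ and composing with the comparison to Extⁿ(QA, RB) gives the last two
  -- statements.
  exact ⟨⟨stableExt r (n + 1) hn, restrict_stableExt r hn, ⟨loopHomIso r ℓ n⟩,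
      ⟨(suspHomIso r s n).symm⟩⟩, ⟨hoExtIso r hn⟩, ⟨restrictIso r (loopHomIso r ℓ n) ≪≫ h⟩,
    ⟨h.symm ≪≫ restrictIso r (suspHomIso r s n).symm⟩⟩
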